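/- Let $M$ be a smooth ($C^\infty$, finite-dimensional, Hausdorff, $\sigma$-compact, boundaryless) manifold, $E\to M$ a smooth real vector bundle of finite rank, $g\in\Gamma\odot^2E^*$ a metric on $E$ (symmetric and non-degenerate on each fibre, of arbitrary signature) and $\rho:E\to TM$ an anchor (a smooth vector bundle morphism over $\mathrm{Id}_M$). For $f\in C^\infty(M)$ let $\partial f\in\Gamma E$ be defined by $g(\partial f,e)=\tfrac12(\rho e)f$. A *metric-algebroid structure* on $(E,g,\rho)$ is an $\mathbb R$-bilinear product $\bigstar:\Gamma E\times\Gamma E\to\Gamma E$ such that, for all $e,e_1,e_2\in\Gamma E$, $$(\rho e)(g(e_1,e_2))=g(e\bigstar e_1,e_2)+g(e_1,e\bigstar e_2),\qquad e\bigstar e=\partial(g(e,e)).$$ A *metric bracket* on $(E,g,\rho)$ is an $\mathbb R$-bilinear, skew-symmetric bracket $[\,,\,]:\Gamma E\times\Gamma E\to\Gamma E$ such that $$(\rho e)(g(e_1,e_2))=g([e,e_1]+\partial(g(e,e_1)),e_2)+g(e_1,[e,e_2]+\partial(g(e,e_2))).$$ **Proposition 2.3.** 1. $(E,g,\rho)$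 admits a metric-algebroid structure. If $M\neq\emptyset$ and $\operatorname{rank}E\ge 3$, it admits infinitely many. 2. Let $\nabla^0$ be any smooth connection on $E$ that preserves $g$, i.e. $X(g(e_1,e_2))=g(\nabla^0_Xe_1,e_2)+g(e_1,\nabla^0_Xe_2)$. Define $e_1\wedge_{\nabla^0}e_2\in\Gamma E$ by $$g(e,e_1\wedge_{\nabla^0}e_2)=\tfrac12\big[g(e_1,\nabla^0_{\rho e}e_2)-g(e_2,\nabla^0_{\rho e}e_1)\big]\quad\text{for all } e.$$ Then $$[e_1,e_2]_{\nabla^0}=\nabla^0_{\rho e_1}e_2-\nabla^0_{\rho e_2}e_1-e_1\wedge_{\nabla^0}e_2$$ is a metric bracket on $(E,g,\rho)$, and the assignment $[\,,\,]\mapsto B$, $$B(e_1,e_2,e_3)=g\big([e_1,e_2]-[e_1,e_2]_{\nabla^0},e_3\big),$$ is a bijection from the set of metric brackets on $(E,g,\rho)$ onto the set $\Gamma\wedge^3E^*$ of smooth $3$-forms on $E$. -/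

import Mathlib

open scoped Manifold ContDiff Bundle

set_option linter.unusedSectionVars false

noncomputable section

namespace MetricAlgebroid

variable {EM : Type*} [NormedAddCommGroup EM] [NormedSpace ℝ EM]
  {H : Type*} [TopologicalSpace H] (I : ModelWithCorners ℝ EM H)
  {M : Type*} [TopologicalSpace M] [ChartedSpace H M]
  (F : Type*) [NormedAddCommGroup F] [NormedSpace ℝ F]
  (V : M → Type*) [TopologicalSpace (Bundle.TotalSpace F V)]
  [∀ x, AddCommGroup (V x)] [∀ x, Module ℝ (V x)] [∀ x, TopologicalSpace (V x)]
  [∀ x, IsTopologicalAddGroup (V x)] [∀ x, ContinuousSMul ℝ (V x)]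
  [FiberBundle F V] [VectorBundle ℝ F V]

/-- The space `Γ V` of (global) smooth sections of the vector bundle `V`. -/
abbrev Sections : Type _ := Cₛ^∞⟮I; F, V⟯

/-- A (pseudo-Euclidean) metric on the vector bundle `V`: a smooth section of `V* ⊗ V*` that is
symmetric and non degenerate on each fibre. No positivity is required. -/
structure BundleMetric where
  /-- The bilinear form on the fibres, as a smooth section of the bundle `Hom(V, Hom(V, ℝ))`. -/
  form : Cₛ^∞⟮I; F →L[ℝ] F →L[ℝ] ℝ, fun x => V x →L[ℝ] V x →L[ℝ] ℝ⟯
  symm : ∀ (x : M) (v w : V x), form x v w = form x w v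
  nondegenerate : ∀ (x : M) (v : V x), (∀ w : V x, form x v w = 0) → v = 0

/-- An anchor: a smooth morphism of vector bundles `V → TM` over the identity of `M`, i.e. a smooth
section of `Hom(V, TM)`. -/
abbrev Anchor [IsManifold I 1 M] : Type _ :=
  Cₛ^∞⟮I; F →L[ℝ] EM, fun x => V x →L[ℝ] TangentSpace I x⟯

/-- The space `Γ ∧³ V*` of smooth `3`-forms on the vector bundle `V`: the smooth sections of the
bundle of alternating trilinear maps on the fibres of `V`. -/
abbrev ThreeForm : Type _ :=
  Cₛ^∞⟮I; F [⋀^Fin 3]→L[ℝ] ℝ, fun x => V x [⋀^Fin 3]→L[ℝ] Bundle.Trivial M ℝ x⟯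

variable {I F V}

namespace BundleMetric

variable (g : BundleMetric I F V)

/-- The function `g(e₁, e₂)` on `M`. -/
def pair (e₁ e₂ : Π x, V x) : M → ℝ := fun x => g.form x (e₁ x) (e₂ x)

/-- The musical map `♭ : V x → (V x)*`, `v ↦ g(v, ·)`. -/
def flat (x : M) : V x →ₗ[ℝ] Module.Dual ℝ (V x) where
  toFun v := (g.form x v : V x →ₗ[ℝ] ℝ)
  map_add' v w := by ext; simp
  map_smul' c v := by ext; simp

theorem flat_apply (x : M) (v w : V x) : g.flat x v w = g.form x v w := rfl

theorem flat_injective (x : M) : Function.Injective (g.flat x) := by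
  rw [injective_iff_map_eq_zero]
  intro v hv
  exact g.nondegenerate x v fun w => by simpa [flat_apply] using LinearMap.congr_fun hv w

variable [FiniteDimensional ℝ F]

/-- The musical isomorphism `♭` of a fibre of finite dimension with its dual. -/
def flatEquiv (x : M) : V x ≃ₗ[ℝ] Module.Dual ℝ (V x) :=
  haveI : FiniteDimensional ℝ (V x) := VectorBundle.finiteDimensional ℝ F V x
  LinearEquiv.ofInjectiveOfFinrankEq (g.flat x) (g.flat_injective x)
    Subspace.dual_finrank_eq.symm

/-- The musical isomorphism `♯ : (V x)* → V x`, characterized by `g(♯ α, v) = α v`. -/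
def sharp (x : M) (α : Module.Dual ℝ (V x)) : V x := (g.flatEquiv x).symm α

theorem form_sharp (x : M) (α : Module.Dual ℝ (V x)) (v : V x) :
    g.form x (g.sharp x α) v = α v := by
  have h : g.flatEquiv x (g.sharp x α) = α := (g.flatEquiv x).apply_symm_apply α
  exact LinearMap.congr_fun h v

end BundleMetric

variable [IsManifold I 1 M]

/-- The function `(ρ e) f` on `M`: the derivative of the function `f` along the vector field
`ρ e`. -/
def anchorDeriv (ρ : Anchor I F V) (e : Π x, V x) (f : M → ℝ) : M → ℝ :=
  fun x => mvfderiv I f x (ρ x (e x))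

variable [FiniteDimensional ℝ F]

/-- The section `∂ f = (1/2) ♯ (ᵗρ (df))` of `V`. -/
def partialGrad (g : BundleMetric I F V) (ρ : Anchor I F V) (f : M → ℝ) : Π x, V x :=
  fun x => (1 / 2 : ℝ) • g.sharp x (((mvfderiv I f x).comp (ρ x) : V x →L[ℝ] ℝ) : V x →ₗ[ℝ] ℝ)

/-- `P` is the product `⋆` of a metric algebroid structure on `(V, g, ρ)`: it is an `ℝ`-bilinear
product `Γ V × Γ V → Γ V` with
1) `(ρ e)(g(e₁, e₂)) = g(e ⋆ e₁, e₂) + g(e₁, e ⋆ e₂)` and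
2) `e ⋆ e = ∂ (g(e, e))`. -/
structure IsMetricProduct (g : BundleMetric I F V) (ρ : Anchor I F V)
    (P : Sections I F V →ₗ[ℝ] Sections I F V →ₗ[ℝ] Sections I F V) : Prop where
  compat : ∀ (e e₁ e₂ : Sections I F V) (x : M),
    anchorDeriv ρ e (g.pair e₁ e₂) x = g.pair (P e e₁) e₂ x + g.pair e₁ (P e e₂) x
  normal : ∀ (e : Sections I F V) (x : M), P e e x = partialGrad g ρ (g.pair e e) x

/-- `b` is a metric bracket on `(V, g, ρ)`: a skew symmetric `ℝ`-bilinear bracket on `Γ V` with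
`(ρ e)(g(e₁, e₂)) = g([e, e₁] + ∂ g(e, e₁), e₂) + g(e₁, [e, e₂] + ∂ g(e, e₂))`. -/
structure IsMetricBracket (g : BundleMetric I F V) (ρ : Anchor I F V)
    (b : Sections I F V →ₗ[ℝ] Sections I F V →ₗ[ℝ] Sections I F V) : Prop where
  skew : ∀ e₁ e₂ : Sections I F V, b e₁ e₂ = -b e₂ e₁
  compat : ∀ (e e₁ e₂ : Sections I F V) (x : M),
    anchorDeriv ρ e (g.pair e₁ e₂) x =
      g.pair (⇑(b e e₁) + partialGrad g ρ (g.pair e e₁)) e₂ x +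
        g.pair e₁ (⇑(b e e₂) + partialGrad g ρ (g.pair e e₂)) x

/-- The connection `∇` preserves the metric `g`: `X (g(e₁, e₂)) = g(∇_X e₁, e₂) + g(e₁, ∇_X e₂)`
for all tangent vectors `X` and smooth sections `e₁`, `e₂`. -/
def Preserves (nabla : CovariantDerivative I F V) (g : BundleMetric I F V) : Prop :=
  ∀ (e₁ e₂ : Sections I F V) (x : M) (X : TangentSpace I x),
    mvfderiv I (g.pair e₁ e₂) x X =
      g.form x (nabla e₁ x X) (e₂ x) + g.form x (e₁ x) (nabla e₂ x X)

/-- The skew symmetric product `e₁ ∧_∇ e₂`, characterized by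
`g(e, e₁ ∧_∇ e₂) = (1/2) (g(e₁, ∇_{ρ e} e₂) - g(e₂, ∇_{ρ e} e₁))`. -/
def wedge (g : BundleMetric I F V) (ρ : Anchor I F V) (nabla : CovariantDerivative I F V)
    (e₁ e₂ : Π x, V x) : Π x, V x :=
  fun x => g.sharp x
    (((1 / 2 : ℝ) • ((g.form x (e₁ x)).comp ((nabla e₂ x).comp (ρ x)) -
      (g.form x (e₂ x)).comp ((nabla e₁ x).comp (ρ x))) : V x →L[ℝ] ℝ) : V x →ₗ[ℝ] ℝ)

/-- The section `∇_{ρ e₁} e₂ - ∇_{ρ e₂} e₁ - e₁ ∧_∇ e₂` of `V`. -/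
def nablaBracket (g : BundleMetric I F V) (ρ : Anchor I F V) (nabla : CovariantDerivative I F V)
    (e₁ e₂ : Π x, V x) : Π x, V x :=
  fun x => nabla e₂ x (ρ x (e₁ x)) - nabla e₁ x (ρ x (e₂ x)) - wedge g ρ nabla e₁ e₂ x

end MetricAlgebroid

end

/-! ### Global smooth sections and smoothness tests. -/

noncomputable section

namespace MetricAlgebroid

open Bundle Filter Topology

variable {EM : Type*} [NormedAddCommGroup EM] [NormedSpace ℝ EM]
  {H : Type*} [TopologicalSpace H] {I : ModelWithCorners ℝ EM H}
  {M : Type*} [TopologicalSpace M] [ChartedSpace H M] [IsManifold I ∞ M]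
  {F : Type*} [NormedAddCommGroup F] [NormedSpace ℝ F]
  {V : M → Type*} [TopologicalSpace (TotalSpace F V)]
  [∀ x, AddCommGroup (V x)] [∀ x, Module ℝ (V x)] [∀ x, TopologicalSpace (V x)]
  [∀ x, IsTopologicalAddGroup (V x)] [∀ x, ContinuousSMul ℝ (V x)]
  [FiberBundle F V] [VectorBundle ℝ F V]

/-! A metric bracket plus the symmetric term ∂g(e₁, e₂) is a metric product, so it is enough to
produce brackets. A metric connection ∇ gives one: in g([e, e₁] + ∂g(e, e₁), e₂) the halves coming
from the wedge and from ∂ combine, leaving g(∇_{ρe} e₁, e₂) and a part skew in e₁, e₂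
(`isMetricBracket_bracket`). Only g(∇_{ρv} e, w) enters, and this is what `AnchoredConnection`
records; the Leibniz rule in e follows from metric compatibility and linearity in w. Such operators
exist over trivializing open sets (`localForm`) and are averaged by a partition of unity
(`nonempty_anchoredConnection`).

Two metric brackets have the same gradient terms, so their difference, paired with a third section,
is skew in all arguments. It is pointwise in the last one, hence in all three (`form_sub_congr`): a
3-form. Conversely, adding ♯B(e₁, e₂, ·) for a 3-form B preserves the axioms. In rank at least 3
over a nonempty base some B is nonzero, and its multiples tB give infinitely many products.

Smoothness is tested on global sections: Cramer's rule for the Gram matrix of a frame handles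
sections (`contMDiff_of_pair`), evaluation on a frame handles forms (`contMDiff_form_of_apply`). -/

/-- The derivative of a smooth function along a smooth vector field is smooth. -/
theorem contMDiffAt_mvfderiv_apply {f : M → ℝ} {X : Π x : M, TangentSpace I x} {x : M}
    (hf : ContMDiffAt I 𝓘(ℝ) ∞ f x)
    (hX : ContMDiffAt I I.tangent ∞ (fun y => (⟨y, X y⟩ : TangentBundle I M)) x) :
    ContMDiffAt I 𝓘(ℝ) ∞ (fun y => mvfderiv I f y (X y)) x := by
  -- This is smoothness of y ↦ (f y, df_y(X y)) into the tangent bundle of ℝ; the fibre component is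
  -- then projected out.
  have h := ContMDiffAt.clm_apply_of_inCoordinates (b₁ := id) (b₂ := f)
    (ϕ := fun y => mfderiv I 𝓘(ℝ) f y) (v := X) (hf.mfderiv_const (m := ∞) (by simp)) hX hf
  exact (contMDiff_snd_tangentBundle_modelSpace ℝ 𝓘(ℝ)).contMDiffAt.comp x h

section Extension

variable [FiniteDimensional ℝ EM] [T2Space M] [SigmaCompactSpace M]

/-- A section which is smooth near a point agrees near this point with a global smooth section. -/
theorem exists_section_eventuallyEq {s : Π x, V x} {U : Set M} (hU : IsOpen U)
    (hs : ContMDiffOn I (I.prod 𝓘(ℝ, F)) ∞ (fun x => TotalSpace.mk' F x (s x)) U)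
    {x₀ : M} (hx₀ : x₀ ∈ U) :
    ∃ e : Sections I F V, ∀ᶠ x in 𝓝 x₀, e x = s x := by
  obtain ⟨t, ht, htc, htU⟩ : ∃ t ∈ 𝓝 x₀, IsClosed t ∧ t ⊆ U := by
    have : LocallyCompactSpace H := I.locallyCompactSpace
    have : LocallyCompactSpace M := ChartedSpace.locallyCompactSpace H M
    exact (closed_nhds_basis x₀).mem_iff.1 (hU.mem_nhds hx₀) |>.imp fun t h => ⟨h.1.1, h.1.2, h.2⟩
  have : NormalSpace M := by
    have : LocallyCompactSpace H := I.locallyCompactSpace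
    have : LocallyCompactSpace M := ChartedSpace.locallyCompactSpace H M
    infer_instance
  -- ψ is 1 near x₀ and 0 off the closed set t ⊆ U, so ψ • s is smooth on all of M.
  obtain ⟨ψ, hψ1, hψ2, -⟩ := exists_contMDiffMap_one_nhds_of_subset_interior (n := (⊤ : ℕ∞)) I
    (isClosed_singleton (x := x₀)) (Set.singleton_subset_iff.2 (mem_interior_iff_mem_nhds.2 ht))
  refine ⟨⟨(ψ : M → ℝ) • s, ?_⟩, ?_⟩
  · refine ContMDiffOn.smul_section_of_tsupport ψ.contMDiff.contMDiffOn hU ?_ hs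
    refine subset_trans (closure_minimal ?_ htc) htU
    intro x hx
    by_contra h
    exact hx (hψ2 x h)
  · rw [nhdsSet_singleton] at hψ1
    filter_upwards [hψ1] with x hx
    simp [hx]

variable [ContMDiffVectorBundle ∞ F V I]

/-- A local frame agrees near a point with global smooth sections. -/
theorem exists_sections_eventuallyEq_localFrame {ι : Type*} [Finite ι] (b : Module.Basis ι ℝ F)
    (x₀ : M) :
    ∃ E : ι → Sections I F V, ∀ᶠ x in 𝓝 x₀, ∀ i,
      E i x = (trivializationAt F V x₀).localFrame b i x := by
  have h : ∀ i, ∃ e : Sections I F V, ∀ᶠ x in 𝓝 x₀,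
      e x = (trivializationAt F V x₀).localFrame b i x := fun i =>
    exists_section_eventuallyEq (trivializationAt F V x₀).open_baseSet
      ((trivializationAt F V x₀).contMDiffOn_localFrame_baseSet ∞ b i)
      (FiberBundle.mem_baseSet_trivializationAt' x₀)
  choose E hE using h
  exact ⟨E, eventually_all.2 hE⟩

variable [FiniteDimensional ℝ F]

/-- Near every point there is a frame made of global smooth sections. -/
theorem exists_sections_frame (x₀ : M) :
    ∃ E : Fin (Module.finrank ℝ F) → Sections I F V, ∀ᶠ x in 𝓝 x₀,
      ⊤ ≤ Submodule.span ℝ (Set.range fun i => E i x) := by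
  let b := Module.finBasis ℝ F
  obtain ⟨E, hE⟩ := exists_sections_eventuallyEq_localFrame (I := I) (V := V) b x₀
  refine ⟨E, ?_⟩
  filter_upwards [hE, (trivializationAt F V x₀).open_baseSet.mem_nhds
    (FiberBundle.mem_baseSet_trivializationAt' x₀)] with x hx hxb
  have := ((trivializationAt F V x₀).isLocalFrameOn_localFrame_baseSet I ∞ b).generating hxb
  simpa only [hx] using this

/-- Every vector is the value of a global smooth section. -/
theorem exists_section_apply_eq (x : M) (v : V x) : ∃ e : Sections I F V, e x = v := by
  obtain ⟨E, hE⟩ := exists_sections_frame (I := I) (F := F) (V := V) x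
  have hv : v ∈ Submodule.span ℝ (Set.range fun i => E i x) := hE.self_of_nhds trivial
  obtain ⟨c, hc⟩ := (Submodule.mem_span_range_iff_exists_fun ℝ).1 hv
  refine ⟨∑ i, c i • E i, ?_⟩
  rw [← hc]
  have h := congrFun (map_sum (ContMDiffSection.coeAddHom I F ∞ V) (fun i => c i • E i)
    Finset.univ) x
  rw [Finset.sum_apply] at h
  exact h

end Extension

section Smoothness

theorem BundleMetric.contMDiffAt_pair (g : BundleMetric I F V) {s t : Π x, V x} {x : M}
    (hs : ContMDiffAt I (I.prod 𝓘(ℝ, F)) ∞ (fun x => TotalSpace.mk' F x (s x)) x)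
    (ht : ContMDiffAt I (I.prod 𝓘(ℝ, F)) ∞ (fun x => TotalSpace.mk' F x (t x)) x) :
    ContMDiffAt I 𝓘(ℝ) ∞ (g.pair s t) x := by
  have h := ContMDiffAt.clm_bundle_apply₂ (F₁ := F) (F₂ := F) (F₃ := ℝ) (E₃ := Bundle.Trivial M ℝ)
    (b := id) (ψ := fun x => g.form x) g.form.contMDiff.contMDiffAt hs ht
  exact (contMDiffAt_section _).1 h

theorem BundleMetric.contMDiff_pair (g : BundleMetric I F V) (e₁ e₂ : Sections I F V) :
    ContMDiff I 𝓘(ℝ) ∞ (g.pair e₁ e₂) := fun _ =>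
  g.contMDiffAt_pair e₁.contMDiff.contMDiffAt e₂.contMDiff.contMDiffAt

theorem contMDiffAt_matrix_det {n : Type*} [Fintype n] [DecidableEq n] {A : M → Matrix n n ℝ}
    {x : M} (hA : ∀ i j, ContMDiffAt I 𝓘(ℝ) ∞ (fun y => A y i j) x) :
    ContMDiffAt I 𝓘(ℝ) ∞ (fun y => (A y).det) x := by
  simp only [Matrix.det_apply']
  refine contMDiffAt_finsetSum fun σ _ =>
    contMDiffAt_const.mul (contMDiffAt_finsetProd fun _ _ => hA _ _)

variable [FiniteDimensional ℝ EM] [T2Space M] [SigmaCompactSpace M]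
  [ContMDiffVectorBundle ∞ F V I] [FiniteDimensional ℝ F]

/-- A section is smooth if its products with all smooth sections are. -/
theorem BundleMetric.contMDiff_of_pair (g : BundleMetric I F V) {s : Π x, V x}
    (hs : ∀ e : Sections I F V, ContMDiff I 𝓘(ℝ) ∞ (g.pair s e)) :
    ContMDiff I (I.prod 𝓘(ℝ, F)) ∞ (fun x => TotalSpace.mk' F x (s x)) := by
  intro x₀
  let n := Module.finrank ℝ F
  obtain ⟨E, hE⟩ := exists_sections_frame (I := I) (F := F) (V := V) x₀
  -- The coefficients c of s in the frame solve G c = d, with G the Gram matrix of the frame and d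
  -- the products of s with it; both are smooth.
  let G : M → Matrix (Fin n) (Fin n) ℝ := fun x => .of fun i j => g.pair (E j) (E i) x
  let d : M → Fin n → ℝ := fun x i => g.pair s (E i) x
  have hG : ∀ i j, ContMDiff I 𝓘(ℝ) ∞ (fun x => G x i j) := fun i j => g.contMDiff_pair _ _
  have hd : ∀ i, ContMDiff I 𝓘(ℝ) ∞ (fun x => d x i) := fun i => hs _
  have hfin : ∀ x, Module.finrank ℝ (V x) = n := fun x => VectorBundle.finrank_eq ℝ F V x
  -- A kernel vector of G would give a combination of the frame orthogonal to the whole fibre, hence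
  -- zero, against linear independence.
  have hGdet : ∀ᶠ x in 𝓝 x₀, (G x).det ≠ 0 := by
    filter_upwards [hE] with x hx hdet
    obtain ⟨v, hv, hv0⟩ := Matrix.exists_mulVec_eq_zero_iff.2 hdet
    have hli : LinearIndependent ℝ fun i => E i x :=
      linearIndependent_of_top_le_span_of_card_eq_finrank hx (by simp [hfin, n])
    have hz : ∑ i, v i • E i x = 0 := by
      refine g.nondegenerate x _ fun w => ?_
      obtain ⟨c, rfl⟩ := (Submodule.mem_span_range_iff_exists_fun ℝ).1 (hx (x := w) trivial)
      rw [map_sum]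
      refine Finset.sum_eq_zero fun i _ => ?_
      have := congrFun hv0 i
      simp only [Matrix.mulVec, dotProduct, G, Matrix.of_apply, BundleMetric.pair,
        Pi.zero_apply] at this
      rw [map_smul, map_sum, sum_apply]
      simp only [map_smul, smul_apply, smul_eq_mul]
      simp only [mul_comm (v _), this, mul_zero]
    exact hv (funext (Fintype.linearIndependent_iff.1 hli v hz))
  have key : ∀ᶠ x in 𝓝 x₀, s x = ∑ i, ((G x).det⁻¹ * (G x).cramer (d x) i) • E i x := by
    filter_upwards [hE, hGdet] with x hx hdet
    rw [← sub_eq_zero]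
    refine g.nondegenerate x _ fun w => ?_
    obtain ⟨c, rfl⟩ := (Submodule.mem_span_range_iff_exists_fun ℝ).1 (hx (x := w) trivial)
    have h := (G x).mulVec_cramer (d x)
    simp only [map_sum, map_smul]
    refine Finset.sum_eq_zero fun j _ => ?_
    have hj := congrFun h j
    rw [Matrix.mulVec, dotProduct, Pi.smul_apply, smul_eq_mul] at hj
    have : g.form x (s x) (E j x) = d x j := rfl
    simp only [map_sub, map_sum, map_smul, sub_apply, this,
      sum_apply, smul_apply, smul_eq_mul]
    have h2 : ∑ i, (G x).det⁻¹ * (G x).cramer (d x) i * g.form x (E i x) (E j x) = d x j := by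
      rw [← mul_right_inj' hdet, ← hj, Finset.mul_sum]
      refine Finset.sum_congr rfl fun i _ => ?_
      rw [← mul_assoc, mul_inv_cancel_left₀ hdet, mul_comm]
      rfl
    rw [h2, sub_self, mul_zero]
  have hc : ∀ i, ContMDiffAt I 𝓘(ℝ) ∞ (fun x => (G x).det⁻¹ * (G x).cramer (d x) i) x₀ := by
    intro i
    refine ContMDiffAt.mul ?_ ?_
    · exact (contMDiffAt_matrix_det fun i j => (hG i j).contMDiffAt).inv₀ hGdet.self_of_nhds
    -- By definition this is the determinant of G with column i replaced by d, again a matrix of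
    -- smooth functions.
    · simp only [Matrix.cramer_apply]
      refine contMDiffAt_matrix_det fun k j => ?_
      by_cases hij : j = i
      · subst hij; simpa using (hd k).contMDiffAt
      · simpa [Matrix.updateCol_apply, hij] using (hG k j).contMDiffAt
  have hsum := ContMDiffAt.sum_section (s := Finset.univ) (n := ∞) fun i _ =>
    (hc i).smul_section ((E i).contMDiff.contMDiffAt (x := x₀))
  refine hsum.congr_of_eventuallyEq ?_
  filter_upwards [key] with x hx
  rw [hx]; rfl

end Smoothness

end MetricAlgebroid

end

/-! ### Raising indices on sections, the gradient term, and the bracket of a metric connection. -/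

noncomputable section

namespace MetricAlgebroid

open Bundle Filter Topology

variable {EM : Type*} [NormedAddCommGroup EM] [NormedSpace ℝ EM] [FiniteDimensional ℝ EM]
  {H : Type*} [TopologicalSpace H] {I : ModelWithCorners ℝ EM H}
  {M : Type*} [TopologicalSpace M] [ChartedSpace H M] [IsManifold I ∞ M]
  [T2Space M] [SigmaCompactSpace M]
  {F : Type*} [NormedAddCommGroup F] [NormedSpace ℝ F] [FiniteDimensional ℝ F]
  {V : M → Type*} [TopologicalSpace (TotalSpace F V)]
  [∀ x, AddCommGroup (V x)] [∀ x, Module ℝ (V x)] [∀ x, TopologicalSpace (V x)]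
  [∀ x, IsTopologicalAddGroup (V x)] [∀ x, ContinuousSMul ℝ (V x)]
  [FiberBundle F V] [VectorBundle ℝ F V] [ContMDiffVectorBundle ∞ F V I]

namespace BundleMetric

variable (g : BundleMetric I F V)

theorem eq_of_form_eq {x : M} {v v' : V x} (h : ∀ w, g.form x v w = g.form x v' w) : v = v' := by
  rw [← sub_eq_zero]
  exact g.nondegenerate x _ fun w => by rw [map_sub, sub_apply, h, sub_self]

/-- The section `♯ α` of a smooth section `α` of the dual bundle. -/
def sharpSection (α : Π x, Module.Dual ℝ (V x))
    (hα : ∀ e : Sections I F V, ContMDiff I 𝓘(ℝ) ∞ fun x => α x (e x)) : Sections I F V where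
  toFun x := g.sharp x (α x)
  contMDiff_toFun := g.contMDiff_of_pair fun e => (hα e).congr fun x => g.form_sharp x (α x) (e x)

theorem form_sharpSection (α : Π x, Module.Dual ℝ (V x))
    (hα : ∀ e : Sections I F V, ContMDiff I 𝓘(ℝ) ∞ fun x => α x (e x)) (x : M) (w : V x) :
    g.form x (g.sharpSection α hα x) w = α x w :=
  g.form_sharp x (α x) w

/-- The `ℝ`-bilinear product `(e₁, e₂) ↦ ♯ (β(e₁, e₂))` on sections. -/
def sharpBilin (β : Sections I F V →ₗ[ℝ] Sections I F V →ₗ[ℝ] Π x, Module.Dual ℝ (V x))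
    (hβ : ∀ e₁ e₂ e₃ : Sections I F V, ContMDiff I 𝓘(ℝ) ∞ fun x => β e₁ e₂ x (e₃ x)) :
    Sections I F V →ₗ[ℝ] Sections I F V →ₗ[ℝ] Sections I F V :=
  LinearMap.mk₂ ℝ (fun e₁ e₂ => g.sharpSection (β e₁ e₂) (hβ e₁ e₂))
    (fun e₁ e₂ e₃ => by
      ext x
      refine g.eq_of_form_eq fun w => (g.form_sharpSection _ _ x w).trans ?_
      simp only [ContMDiffSection.coe_add, Pi.add_apply, map_add, LinearMap.add_apply]
      exact (congrArg₂ (· + ·) (g.form_sharpSection _ (hβ e₁ e₃) x w)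
        (g.form_sharpSection _ (hβ e₂ e₃) x w)).symm)
    (fun c e₁ e₂ => by
      ext x
      refine g.eq_of_form_eq fun w => (g.form_sharpSection _ _ x w).trans ?_
      simp only [ContMDiffSection.coe_smul, Pi.smul_apply, map_smul, LinearMap.smul_apply]
      exact (congrArg (c • ·) (g.form_sharpSection _ (hβ e₁ e₂) x w)).symm)
    (fun e₁ e₂ e₃ => by
      ext x
      refine g.eq_of_form_eq fun w => (g.form_sharpSection _ _ x w).trans ?_
      simp only [ContMDiffSection.coe_add, Pi.add_apply, map_add, LinearMap.add_apply]
      exact (congrArg₂ (· + ·) (g.form_sharpSection _ (hβ e₁ e₂) x w)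
        (g.form_sharpSection _ (hβ e₁ e₃) x w)).symm)
    (fun c e₁ e₂ => by
      ext x
      refine g.eq_of_form_eq fun w => (g.form_sharpSection _ _ x w).trans ?_
      simp only [ContMDiffSection.coe_smul, Pi.smul_apply, map_smul, LinearMap.smul_apply]
      exact (congrArg (c • ·) (g.form_sharpSection _ (hβ e₁ e₂) x w)).symm)

theorem form_sharpBilin
    (β : Sections I F V →ₗ[ℝ] Sections I F V →ₗ[ℝ] Π x, Module.Dual ℝ (V x))
    (hβ : ∀ e₁ e₂ e₃ : Sections I F V, ContMDiff I 𝓘(ℝ) ∞ fun x => β e₁ e₂ x (e₃ x))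
    (e₁ e₂ : Sections I F V) (x : M) (w : V x) :
    g.form x (g.sharpBilin β hβ e₁ e₂ x) w = β e₁ e₂ x w :=
  g.form_sharpSection _ (hβ e₁ e₂) x w

theorem pair_add_left (e₁ e₂ e₃ : Sections I F V) :
    g.pair (e₁ + e₂ : Sections I F V) e₃ = g.pair e₁ e₃ + g.pair e₂ e₃ := by
  ext x; simp [pair]

theorem pair_smul_left (c : ℝ) (e₁ e₂ : Sections I F V) :
    g.pair (c • e₁ : Sections I F V) e₂ = fun x => c * g.pair e₁ e₂ x := by
  ext x; simp [pair]

theorem pair_comm (e₁ e₂ : Π x, V x) : g.pair e₁ e₂ = g.pair e₂ e₁ :=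
  funext fun x => g.symm x _ _

end BundleMetric

section Gradient

variable (g : BundleMetric I F V) (ρ : Anchor I F V)

theorem form_partialGrad (f : M → ℝ) (x : M) (w : V x) :
    g.form x (partialGrad g ρ f x) w = 1 / 2 * mvfderiv I f x (ρ x w) := by
  rw [partialGrad, map_smul, smul_apply, BundleMetric.form_sharp, smul_eq_mul]
  rfl

theorem contMDiff_anchorDeriv {f : M → ℝ} (hf : ContMDiff I 𝓘(ℝ) ∞ f) (e : Sections I F V) :
    ContMDiff I 𝓘(ℝ) ∞ (anchorDeriv ρ e f) := fun _ =>
  contMDiffAt_mvfderiv_apply hf.contMDiffAt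
    (ContMDiffAt.clm_bundle_apply (E₂ := fun x : M => TangentSpace I x) (b := id)
      ρ.contMDiff.contMDiffAt e.contMDiff.contMDiffAt)

theorem mdifferentiableAt_pair (e₁ e₂ : Sections I F V) (x : M) :
    MDifferentiableAt I 𝓘(ℝ) (g.pair e₁ e₂) x :=
  (g.contMDiff_pair e₁ e₂).mdifferentiableAt (by simp)

theorem mvfderiv_pair_add_left (e₁ e₂ e₃ : Sections I F V) (x : M) :
    mvfderiv I (g.pair (e₁ + e₂ : Sections I F V) e₃) x =
      mvfderiv I (g.pair e₁ e₃) x + mvfderiv I (g.pair e₂ e₃) x := by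
  rw [g.pair_add_left]
  exact mvfderiv_add (mdifferentiableAt_pair g _ _ x) (mdifferentiableAt_pair g _ _ x)

theorem mvfderiv_const_mul {f : M → ℝ} {x : M} (hf : MDifferentiableAt I 𝓘(ℝ) f x) (c : ℝ) :
    mvfderiv I (fun y => c * f y) x = c • mvfderiv I f x := by
  have h := mvfderiv_mul (I := I) (f := fun _ : M => c) (g := f) (x := x)
    mdifferentiableAt_const hf
  rw [mvfderiv_const, smul_zero, add_zero] at h
  exact h

theorem mvfderiv_pair_smul_left (c : ℝ) (e₁ e₂ : Sections I F V) (x : M) :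
    mvfderiv I (g.pair (c • e₁ : Sections I F V) e₂) x = c • mvfderiv I (g.pair e₁ e₂) x := by
  rw [g.pair_smul_left]
  exact mvfderiv_const_mul (mdifferentiableAt_pair g _ _ x) c

/-- The bilinear map `(e₁, e₂) ↦ g(∂ (g(e₁, e₂)), ·)`. -/
def gradPairForm : Sections I F V →ₗ[ℝ] Sections I F V →ₗ[ℝ] Π x, Module.Dual ℝ (V x) :=
  LinearMap.mk₂ ℝ
    (fun e₁ e₂ x => (1 / 2 : ℝ) • (((mvfderiv I (g.pair e₁ e₂) x).comp (ρ x) : V x →L[ℝ] ℝ) :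
      V x →ₗ[ℝ] ℝ))
    (fun e₁ e₂ e₃ => by
      ext x w
      rw [mvfderiv_pair_add_left]
      exact mul_add _ _ _)
    (fun c e₁ e₂ => by
      ext x w
      rw [mvfderiv_pair_smul_left]
      exact mul_left_comm _ _ _)
    (fun e₁ e₂ e₃ => by
      ext x w
      simp only [g.pair_comm e₁]
      rw [mvfderiv_pair_add_left]
      exact mul_add _ _ _)
    (fun c e₁ e₂ => by
      ext x w
      simp only [g.pair_comm e₁]
      rw [mvfderiv_pair_smul_left]
      exact mul_left_comm _ _ _)

/-- The symmetric product `(e₁, e₂) ↦ ∂ (g(e₁, e₂))`. -/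
def gradPair : Sections I F V →ₗ[ℝ] Sections I F V →ₗ[ℝ] Sections I F V :=
  g.sharpBilin (gradPairForm g ρ) fun e₁ e₂ e₃ =>
    contMDiff_const.mul (contMDiff_anchorDeriv ρ (g.contMDiff_pair e₁ e₂) e₃)

theorem gradPair_apply (e₁ e₂ : Sections I F V) (x : M) :
    gradPair g ρ e₁ e₂ x = partialGrad g ρ (g.pair e₁ e₂) x :=
  g.eq_of_form_eq fun w =>
    (g.form_sharpBilin _ _ e₁ e₂ x w).trans (form_partialGrad g ρ _ x w).symm

/-- A metric bracket `[ , ]` defines the metric product `e₁ ⋆ e₂ = [e₁, e₂] + ∂ (g(e₁, e₂))`. -/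
theorem IsMetricBracket.isMetricProduct {g : BundleMetric I F V} {ρ : Anchor I F V}
    {b : Sections I F V →ₗ[ℝ] Sections I F V →ₗ[ℝ] Sections I F V} (hb : IsMetricBracket g ρ b) :
    IsMetricProduct g ρ (b + gradPair g ρ) where
  compat e e₁ e₂ x := by
    have h : ∀ e e' : Sections I F V, ⇑((b + gradPair g ρ) e e') =
        ⇑(b e e') + partialGrad g ρ (g.pair e e') := fun e e' => by
      ext x
      exact congrArg (b e e' x + ·) (gradPair_apply g ρ e e' x)
    rw [hb.compat e e₁ e₂ x, h, h]
  normal e x := by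
    have h : b e e x = -b e e x := congrArg (fun s : Sections I F V => s x) (hb.skew e e)
    have h0 : b e e x = 0 := by
      have h2 : (2 : ℝ) • b e e x = 0 := by rw [two_smul]; nth_rw 1 [h]; exact neg_add_cancel _
      exact (smul_eq_zero.1 h2).resolve_left two_ne_zero
    rw [LinearMap.add_apply, LinearMap.add_apply, ContMDiffSection.coe_add, Pi.add_apply, h0,
      zero_add, gradPair_apply]

end Gradient

/-- A smooth operator `∇_ρ : Γ V × Γ V → Γ V`, `(v, e) ↦ ∇_{ρ v} e`, which is tensorial in `v` and
preserves the metric `g`; it is described by `toFun e x v w = g(∇_{ρ v} e, w)`. -/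
structure AnchoredConnection (g : BundleMetric I F V) (ρ : Anchor I F V) where
  /-- The map `(e, v, w) ↦ g(∇_{ρ v} e, w)`. -/
  toFun : Sections I F V →ₗ[ℝ] Π x, V x →ₗ[ℝ] V x →ₗ[ℝ] ℝ
  contMDiff : ∀ e e₁ e₂ : Sections I F V,
    ContMDiff I 𝓘(ℝ) ∞ fun x => toFun e x (e₁ x) (e₂ x)
  preserves : ∀ (e₁ e₂ : Sections I F V) (x : M) (v : V x),
    mvfderiv I (g.pair e₁ e₂) x (ρ x v) = toFun e₁ x v (e₂ x) + toFun e₂ x v (e₁ x)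

namespace AnchoredConnection

variable {g : BundleMetric I F V} {ρ : Anchor I F V} (T : AnchoredConnection g ρ)

/-- The form `g([e₁, e₂], ·)` for the bracket `[ , ]` of a metric connection. -/
def bracketForm : Sections I F V →ₗ[ℝ] Sections I F V →ₗ[ℝ] Π x, Module.Dual ℝ (V x) :=
  LinearMap.mk₂ ℝ
    (fun e₁ e₂ x => T.toFun e₂ x (e₁ x) - T.toFun e₁ x (e₂ x) -
      (1 / 2 : ℝ) • ((T.toFun e₂ x).flip (e₁ x) - (T.toFun e₁ x).flip (e₂ x)))
    (fun e₁ e₂ e₃ => by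
      ext x w
      simp
      ring)
    (fun c e₁ e₂ => by
      ext x w
      simp
      ring)
    (fun e₁ e₂ e₃ => by
      ext x w
      simp
      ring)
    (fun c e₁ e₂ => by
      ext x w
      simp
      ring)

/-- The bracket `[e₁, e₂] = ∇_{ρ e₁} e₂ - ∇_{ρ e₂} e₁ - e₁ ∧ e₂` of a metric connection. -/
def bracket : Sections I F V →ₗ[ℝ] Sections I F V →ₗ[ℝ] Sections I F V :=
  g.sharpBilin T.bracketForm fun e₁ e₂ e =>
      ((T.contMDiff e₂ e₁ e).sub (T.contMDiff e₁ e₂ e)).sub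
        (contMDiff_const.mul ((T.contMDiff e₂ e e₁).sub (T.contMDiff e₁ e e₂)))

theorem form_bracket (e₁ e₂ : Sections I F V) (x : M) (w : V x) :
    g.form x (T.bracket e₁ e₂ x) w = T.toFun e₂ x (e₁ x) w - T.toFun e₁ x (e₂ x) w -
      1 / 2 * (T.toFun e₂ x w (e₁ x) - T.toFun e₁ x w (e₂ x)) :=
  g.form_sharpBilin _ _ e₁ e₂ x w

/-- Expanding ∂g(e, e₁) by metric compatibility gives g([e, e₁] + ∂g(e, e₁), e₂) = g(∇_{ρe} e₁, e₂)
- g(∇_{ρe₁} e, e₂) + g(∇_{ρe₂} e, e₁). The last two terms are skew in e₁, e₂, so adding the same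
expression with e₁, e₂ exchanged leaves (ρe)g(e₁, e₂). -/
theorem isMetricBracket_bracket : IsMetricBracket g ρ T.bracket where
  skew e₁ e₂ := by
    ext x
    refine g.eq_of_form_eq fun w => ?_
    rw [ContMDiffSection.coe_neg, Pi.neg_apply, map_neg, neg_apply, form_bracket, form_bracket]
    ring
  compat e e₁ e₂ x := by
    rw [anchorDeriv, g.pair_comm e₁ (_ + _), T.preserves]
    simp only [BundleMetric.pair, Pi.add_apply, map_add, add_apply, form_bracket,
      form_partialGrad]
    rw [T.preserves, T.preserves]
    ring

end AnchoredConnection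

end MetricAlgebroid

end

/-! ### From covariant derivatives to anchored connections. -/

noncomputable section

namespace MetricAlgebroid

open Bundle Filter Topology

variable {EM : Type*} [NormedAddCommGroup EM] [NormedSpace ℝ EM] [FiniteDimensional ℝ EM]
  {H : Type*} [TopologicalSpace H] {I : ModelWithCorners ℝ EM H}
  {M : Type*} [TopologicalSpace M] [ChartedSpace H M] [IsManifold I ∞ M]
  [T2Space M] [SigmaCompactSpace M]
  {F : Type*} [NormedAddCommGroup F] [NormedSpace ℝ F] [FiniteDimensional ℝ F]
  {V : M → Type*} [TopologicalSpace (TotalSpace F V)]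
  [∀ x, AddCommGroup (V x)] [∀ x, Module ℝ (V x)] [∀ x, TopologicalSpace (V x)]
  [∀ x, IsTopologicalAddGroup (V x)] [∀ x, ContinuousSMul ℝ (V x)]
  [FiberBundle F V] [VectorBundle ℝ F V] [ContMDiffVectorBundle ∞ F V I]

namespace AnchoredConnection

variable {g : BundleMetric I F V} (ρ : Anchor I F V)

/-- The map `(e, v, w) ↦ g(∇_{ρ v} e, w)` for a connection `∇`. -/
def formOfCovariantDerivative (g : BundleMetric I F V) (nabla : CovariantDerivative I F V) :
    Sections I F V →ₗ[ℝ] Π x, V x →ₗ[ℝ] V x →ₗ[ℝ] ℝ where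
  toFun e x := LinearMap.mk₂ ℝ (fun v w => g.form x (nabla e x (ρ x v)) w)
    (fun v v' w => by simp only [map_add, add_apply])
    (fun c v w => by simp only [map_smul, smul_apply])
    (fun v w w' => by simp only [map_add])
    (fun c v w => by simp only [map_smul])
  map_add' e e' := by
    ext x v w
    have h := nabla.isCovariantDerivativeOnUniv.add (e.mdifferentiableAt (x := x))
      (e'.mdifferentiableAt (x := x))
    simp only [ContMDiffSection.coe_add, h, Pi.add_apply, LinearMap.add_apply,
      LinearMap.mk₂_apply, add_apply, map_add]
  map_smul' c e := by
    ext x v w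
    have h := nabla.isCovariantDerivativeOnUniv.smul_const c (e.mdifferentiableAt (x := x))
    simp only [ContMDiffSection.coe_smul, h, Pi.smul_apply, LinearMap.smul_apply,
      LinearMap.mk₂_apply, smul_apply, map_smul, RingHom.id_apply]

theorem formOfCovariantDerivative_apply (nabla : CovariantDerivative I F V)
    (e : Sections I F V) (x : M) (v w : V x) :
    formOfCovariantDerivative ρ g nabla e x v w = g.form x (nabla e x (ρ x v)) w := rfl

theorem contMDiff_covariantDerivative_anchor (nabla : CovariantDerivative I F V)
    (hs : nabla.ContMDiffCovariantDerivative ∞) (e e₁ : Sections I F V) :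
    ContMDiff I (I.prod 𝓘(ℝ, F)) ∞ (fun x => TotalSpace.mk' F x (nabla e x (ρ x (e₁ x)))) := by
  intro x
  have h1 := hs.contMDiff.contMDiff (σ := e) e.contMDiff.contMDiffOn
  rw [contMDiffOn_univ] at h1
  have h2 : ContMDiffAt I (I.prod 𝓘(ℝ, EM)) ∞
      (fun x => TotalSpace.mk' EM (E := fun x : M => TangentSpace I x) x (ρ x (e₁ x))) x :=
    ContMDiffAt.clm_bundle_apply (E₂ := fun x : M => TangentSpace I x) (b := id)
      ρ.contMDiff.contMDiffAt e₁.contMDiff.contMDiffAt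
  exact ContMDiffAt.clm_bundle_apply (b := id) h1.contMDiffAt h2

/-- The operator `(v, e) ↦ ∇_{ρ v} e` for a smooth connection `∇` which preserves the metric. -/
def ofCovariantDerivative (nabla : CovariantDerivative I F V)
    (hs : nabla.ContMDiffCovariantDerivative ∞) (hg : Preserves nabla g) :
    AnchoredConnection g ρ where
  toFun := formOfCovariantDerivative ρ g nabla
  contMDiff e e₁ e₂ x := g.contMDiffAt_pair
    (contMDiff_covariantDerivative_anchor ρ nabla hs e e₁).contMDiffAt e₂.contMDiff.contMDiffAt
  preserves e₁ e₂ x v := by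
    refine (hg e₁ e₂ x (ρ x v)).trans ?_
    rw [formOfCovariantDerivative_apply, formOfCovariantDerivative_apply, g.symm x (e₁ x)]

theorem bracket_ofCovariantDerivative (nabla : CovariantDerivative I F V)
    (hs : nabla.ContMDiffCovariantDerivative ∞) (hg : Preserves nabla g)
    (e₁ e₂ : Sections I F V) (x : M) :
    (ofCovariantDerivative ρ nabla hs hg).bracket e₁ e₂ x = nablaBracket g ρ nabla e₁ e₂ x := by
  refine g.eq_of_form_eq fun w => (form_bracket _ e₁ e₂ x w).trans ?_
  simp only [nablaBracket, wedge, map_sub, sub_apply, BundleMetric.form_sharp]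
  change g.form x (nabla e₂ x (ρ x (e₁ x))) w - g.form x (nabla e₁ x (ρ x (e₂ x))) w -
      1 / 2 * (g.form x (nabla e₂ x (ρ x w)) (e₁ x) - g.form x (nabla e₁ x (ρ x w)) (e₂ x)) =
    g.form x (nabla e₂ x (ρ x (e₁ x))) w - g.form x (nabla e₁ x (ρ x (e₂ x))) w -
      1 / 2 * (g.form x (e₁ x) (nabla e₂ x (ρ x w)) - g.form x (e₂ x) (nabla e₁ x (ρ x w)))
  rw [g.symm x (e₁ x), g.symm x (e₂ x)]

end AnchoredConnection

end MetricAlgebroid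

end

/-! ### Continuity and smoothness of alternating forms. -/

noncomputable section

namespace MetricAlgebroid

open Bundle Filter Topology

variable {EM : Type*} [NormedAddCommGroup EM] [NormedSpace ℝ EM] [FiniteDimensional ℝ EM]
  {H : Type*} [TopologicalSpace H] {I : ModelWithCorners ℝ EM H}
  {M : Type*} [TopologicalSpace M] [ChartedSpace H M] [IsManifold I ∞ M]
  [T2Space M] [SigmaCompactSpace M]
  {F : Type*} [NormedAddCommGroup F] [NormedSpace ℝ F] [FiniteDimensional ℝ F]
  {V : M → Type*} [TopologicalSpace (TotalSpace F V)]
  [∀ x, AddCommGroup (V x)] [∀ x, Module ℝ (V x)] [∀ x, TopologicalSpace (V x)]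
  [∀ x, IsTopologicalAddGroup (V x)] [∀ x, ContinuousSMul ℝ (V x)]
  [FiberBundle F V] [VectorBundle ℝ F V] [ContMDiffVectorBundle ∞ F V I]

section Multilinear

/-- Reduces continuity, equality and smoothness of forms to finitely many values on tuples of basis
vectors. -/
theorem multilinearMap_apply_eq_sum_basis {κ ι E : Type*} [Fintype κ] [DecidableEq κ] [Fintype ι]
    [AddCommGroup E] [Module ℝ E] (b : Module.Basis ι ℝ E)
    (f : MultilinearMap ℝ (fun _ : κ => E) ℝ) (v : κ → E) :
    f v = ∑ r : κ → ι, (∏ i, b.repr (v i) (r i)) * f fun i => b (r i) := by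
  conv_lhs => rw [show v = fun i => ∑ j, b.repr (v i) j • b j from
    funext fun i => (b.sum_repr (v i)).symm]
  rw [f.map_sum]
  exact Finset.sum_congr rfl fun r _ => f.map_smul_univ _ _

/-- Meant for the fibres `V x`, which have a vector space topology but no chosen norm. -/
theorem continuous_multilinearMap_of_finiteDimensional {κ E : Type*} [Fintype κ] [DecidableEq κ]
    [AddCommGroup E] [Module ℝ E] [TopologicalSpace E] [IsTopologicalAddGroup E]
    [ContinuousSMul ℝ E] [T2Space E] [FiniteDimensional ℝ E]
    (f : MultilinearMap ℝ (fun _ : κ => E) ℝ) : Continuous f := by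
  let b := Module.finBasis ℝ E
  have h : ⇑f = fun v => ∑ r : κ → _, (∏ i, b.coord (r i) (v i)) * f fun i => b (r i) :=
    funext fun v => multilinearMap_apply_eq_sum_basis b f v
  rw [h]
  exact continuous_finsetSum _ fun r _ => (continuous_finsetProd _ fun i _ =>
    (b.coord (r i)).continuous_of_finiteDimensional.comp (continuous_apply i)).mul
      continuous_const

end Multilinear

section SmoothForms

theorem finiteDimensional_continuousAlternatingMap (E κ : Type*) [Fintype κ]
    [NormedAddCommGroup E] [NormedSpace ℝ E] [FiniteDimensional ℝ E] :
    FiniteDimensional ℝ (E [⋀^κ]→L[ℝ] ℝ) := by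
  let l : (E [⋀^κ]→L[ℝ] ℝ) →ₗ[ℝ] MultilinearMap ℝ (fun _ : κ => E) ℝ :=
    { toFun f := f.toContinuousMultilinearMap.toMultilinearMap
      map_add' _ _ := rfl
      map_smul' _ _ := rfl }
  refine FiniteDimensional.of_injective l fun f f' h => ?_
  ext v
  exact congrArg (fun m : MultilinearMap ℝ (fun _ : κ => E) ℝ => m v) h

/-- A family of continuous alternating forms on a finite dimensional space is smooth if its values
on the vectors of a basis are. -/
theorem contMDiffAt_continuousAlternatingMap {κ ι E : Type*} [Fintype κ] [DecidableEq κ] [Fintype ι]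
    [NormedAddCommGroup E] [NormedSpace ℝ E] [FiniteDimensional ℝ E] (b : Module.Basis ι ℝ E)
    {f : M → E [⋀^κ]→L[ℝ] ℝ} {x : M}
    (hf : ∀ r : κ → ι, ContMDiffAt I 𝓘(ℝ) ∞ (fun y => f y fun i => b (r i)) x) :
    ContMDiffAt I 𝓘(ℝ, E [⋀^κ]→L[ℝ] ℝ) ∞ f x := by
  have := finiteDimensional_continuousAlternatingMap E κ
  let ev : (E [⋀^κ]→L[ℝ] ℝ) →ₗ[ℝ] ((κ → ι) → ℝ) :=
    { toFun f r := f fun i => b (r i)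
      map_add' _ _ := rfl
      map_smul' _ _ := rfl }
  have hinj : LinearMap.ker ev = ⊥ := by
    refine LinearMap.ker_eq_bot.2 fun f f' h => ?_
    ext v
    have hf := multilinearMap_apply_eq_sum_basis b f.toContinuousMultilinearMap.toMultilinearMap v
    have hf' := multilinearMap_apply_eq_sum_basis b f'.toContinuousMultilinearMap.toMultilinearMap v
    refine hf.trans (Eq.trans ?_ hf'.symm)
    exact Finset.sum_congr rfl fun r _ => congrArg (_ * ·) (congrFun h r)
  obtain ⟨l, hl⟩ := ev.exists_leftInverse_of_injective hinj
  -- Evaluation on basis tuples is injective, so a linear left inverse recovers f from its smooth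
  -- values.
  have h : f = fun y => l.toContinuousLinearMap (ev (f y)) :=
    funext fun y => (LinearMap.congr_fun hl (f y)).symm
  rw [h]
  exact l.toContinuousLinearMap.contMDiff.contMDiffAt.comp x (contMDiffAt_pi_space.2 hf)

theorem inCoordinates_trivial_apply {κ : Type*} {x₀ x : M}
    (φ : V x [⋀^κ]→L[ℝ] Bundle.Trivial M ℝ x) (v : κ → F) :
    ContinuousAlternatingMap.inCoordinates F ℝ x₀ x x₀ x φ v =
      φ fun i => (trivializationAt F V x₀).symmL ℝ x (v i) := by
  simp [ContinuousAlternatingMap.inCoordinates, Function.comp_def]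

variable {κ : Type*} [Fintype κ] [DecidableEq κ]

/-- Near x₀ the value is a finite sum of products of coordinates of the sections with coordinates of
B, all of them smooth. -/
theorem contMDiffAt_form_apply {B : Π x, V x [⋀^κ]→L[ℝ] Bundle.Trivial M ℝ x} {x₀ : M}
    (hB : ContMDiffAt I (I.prod 𝓘(ℝ, F [⋀^κ]→L[ℝ] ℝ)) ∞
      (fun x => TotalSpace.mk' (F [⋀^κ]→L[ℝ] ℝ)
        (E := fun x => V x [⋀^κ]→L[ℝ] Bundle.Trivial M ℝ x) x (B x)) x₀)
    (e : κ → Sections I F V) :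
    ContMDiffAt I 𝓘(ℝ) ∞ (fun x => (B x fun i => e i x : ℝ)) x₀ := by
  let b := Module.finBasis ℝ F
  have h := (contMDiffAt_section x₀).1 hB
  have he : ∀ i, ContMDiffAt I 𝓘(ℝ, F) ∞
      (fun x => (trivializationAt F V x₀ ⟨x, e i x⟩).2) x₀ := fun i =>
    (contMDiffAt_section x₀).1 ((e i).contMDiff x₀)
  have hsum : ContMDiffAt I 𝓘(ℝ) ∞ (fun x => ∑ r : κ → _,
      (∏ i, b.coord (r i) (trivializationAt F V x₀ ⟨x, e i x⟩).2) *
        ContinuousAlternatingMap.inCoordinates F ℝ x₀ x x₀ x (B x) fun i => b (r i)) x₀ := by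
    refine contMDiffAt_finsetSum fun r _ => (contMDiffAt_finsetProd fun i _ => ?_).mul ?_
    · exact (b.coord (r i)).toContinuousLinearMap.contMDiff.contMDiffAt.comp x₀ (he i)
    · exact (ContinuousAlternatingMap.apply ℝ F ℝ fun i => b (r i)).contMDiff.contMDiffAt.comp x₀ h
  refine hsum.congr_of_eventuallyEq ?_
  filter_upwards [(trivializationAt F V x₀).open_baseSet.mem_nhds
    (FiberBundle.mem_baseSet_trivializationAt' x₀)] with x hx
  have h1 := multilinearMap_apply_eq_sum_basis b (ContinuousAlternatingMap.inCoordinates F ℝ x₀ x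
    x₀ x (B x)).toContinuousMultilinearMap.toMultilinearMap
    fun i => (trivializationAt F V x₀ ⟨x, e i x⟩).2
  refine Eq.trans ?_ h1
  refine Eq.trans ?_ (inCoordinates_trivial_apply (x₀ := x₀) (B x) _).symm
  refine congrArg (B x) (funext fun i => ?_)
  simp [hx]

/-- A section of the bundle of alternating forms is smooth if its values on smooth sections are. -/
theorem contMDiff_form_of_apply {B : Π x, V x [⋀^κ]→L[ℝ] Bundle.Trivial M ℝ x}
    (hB : ∀ e : κ → Sections I F V, ContMDiff I 𝓘(ℝ) ∞ (fun x => (B x fun i => e i x : ℝ))) :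
    ContMDiff I (I.prod 𝓘(ℝ, F [⋀^κ]→L[ℝ] ℝ)) ∞
      (fun x => TotalSpace.mk' (F [⋀^κ]→L[ℝ] ℝ)
        (E := fun x => V x [⋀^κ]→L[ℝ] Bundle.Trivial M ℝ x) x (B x)) := by
  intro x₀
  let b := Module.finBasis ℝ F
  obtain ⟨E, hE⟩ := exists_sections_eventuallyEq_localFrame (I := I) (V := V) b x₀
  refine (contMDiffAt_section x₀).2 (contMDiffAt_continuousAlternatingMap b fun r => ?_)
  refine (hB fun i => E (r i)).contMDiffAt.congr_of_eventuallyEq ?_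
  filter_upwards [hE, (trivializationAt F V x₀).open_baseSet.mem_nhds
    (FiberBundle.mem_baseSet_trivializationAt' x₀)] with x hx hxb
  -- In the trivialization, B on basis vectors is B on the local frame, which near x₀ consists of
  -- the global sections `E`.
  refine (inCoordinates_trivial_apply (x₀ := x₀) (B x) _).trans ?_
  refine congrArg (B x) (funext fun i => ?_)
  rw [hx, Trivialization.localFrame_apply_of_mem_baseSet _ _ hxb, Trivialization.basisAt,
    Module.Basis.map_apply]
  simp [hxb]

end SmoothForms

end MetricAlgebroid

end

/-! ### Metric brackets as an affine space over the 3-forms. -/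

noncomputable section

namespace MetricAlgebroid

open Bundle Filter Topology

variable {EM : Type*} [NormedAddCommGroup EM] [NormedSpace ℝ EM] [FiniteDimensional ℝ EM]
  {H : Type*} [TopologicalSpace H] {I : ModelWithCorners ℝ EM H}
  {M : Type*} [TopologicalSpace M] [ChartedSpace H M] [IsManifold I ∞ M]
  [T2Space M] [SigmaCompactSpace M]
  {F : Type*} [NormedAddCommGroup F] [NormedSpace ℝ F] [FiniteDimensional ℝ F]
  {V : M → Type*} [TopologicalSpace (TotalSpace F V)]
  [∀ x, AddCommGroup (V x)] [∀ x, Module ℝ (V x)] [∀ x, TopologicalSpace (V x)]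
  [∀ x, IsTopologicalAddGroup (V x)] [∀ x, ContinuousSMul ℝ (V x)]
  [FiberBundle F V] [VectorBundle ℝ F V] [ContMDiffVectorBundle ∞ F V I]

section AlternatingForms

/-- The linear form `u ↦ A(v, w, u)` for an alternating form `A`. -/
def alternatingDual {W : Type*} [AddCommGroup W] [Module ℝ W] (A : W [⋀^Fin 3]→ₗ[ℝ] ℝ) (v w : W) :
    Module.Dual ℝ W where
  toFun u := A ![v, w, u]
  map_add' u u' := congrArg (fun f : W [⋀^Fin 0]→ₗ[ℝ] ℝ => f ![])
    (((A.curryLeft v).curryLeft w).curryLeft.map_add u u')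
  map_smul' c u := congrArg (fun f : W [⋀^Fin 0]→ₗ[ℝ] ℝ => f ![])
    (((A.curryLeft v).curryLeft w).curryLeft.map_smul c u)

/-- The bilinear map `(e₁, e₂) ↦ A(e₁, e₂, ·)` for a field `A` of alternating forms. -/
def alternatingForm (A : Π x, V x [⋀^Fin 3]→ₗ[ℝ] ℝ) :
    Sections I F V →ₗ[ℝ] Sections I F V →ₗ[ℝ] Π x, Module.Dual ℝ (V x) :=
  LinearMap.mk₂ ℝ (fun e₁ e₂ x => alternatingDual (A x) (e₁ x) (e₂ x))
    (fun e₁ e₂ e₃ => by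
      ext x w
      exact congrArg (fun f : V x [⋀^Fin 2]→ₗ[ℝ] ℝ => f ![e₃ x, w])
        ((A x).curryLeft.map_add (e₁ x) (e₂ x)))
    (fun c e₁ e₂ => by
      ext x w
      exact congrArg (fun f : V x [⋀^Fin 2]→ₗ[ℝ] ℝ => f ![e₂ x, w])
        ((A x).curryLeft.map_smul c (e₁ x)))
    (fun e₁ e₂ e₃ => by
      ext x w
      exact congrArg (fun f : V x [⋀^Fin 1]→ₗ[ℝ] ℝ => f ![w])
        (((A x).curryLeft (e₁ x)).curryLeft.map_add (e₂ x) (e₃ x)))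
    (fun c e₁ e₂ => by
      ext x w
      exact congrArg (fun f : V x [⋀^Fin 1]→ₗ[ℝ] ℝ => f ![w])
        (((A x).curryLeft (e₁ x)).curryLeft.map_smul c (e₂ x)))

theorem alternatingForm_apply (A : Π x, V x [⋀^Fin 3]→ₗ[ℝ] ℝ) (e₁ e₂ : Sections I F V) (x : M)
    (w : V x) : alternatingForm A e₁ e₂ x w = A x ![e₁ x, e₂ x, w] := rfl

theorem alternating_swap_left {W : Type*} [AddCommGroup W] [Module ℝ W]
    (A : W [⋀^Fin 3]→ₗ[ℝ] ℝ) (u v w : W) : A ![u, v, w] = -A ![v, u, w] := by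
  rw [← A.map_swap ![v, u, w] (show (0 : Fin 3) ≠ 1 by decide)]
  congr 1
  ext i
  fin_cases i <;> rfl

theorem alternating_swap_right {W : Type*} [AddCommGroup W] [Module ℝ W]
    (A : W [⋀^Fin 3]→ₗ[ℝ] ℝ) (u v w : W) : A ![u, v, w] = -A ![u, w, v] := by
  rw [← A.map_swap ![u, w, v] (show (1 : Fin 3) ≠ 2 by decide)]
  congr 1
  ext i
  fin_cases i <;> rfl

variable {g : BundleMetric I F V} {ρ : Anchor I F V}

/-- The sum of a metric bracket and `♯ A(e₁, e₂, ·)`, for a `3`-form `A`, is a metric bracket. -/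
theorem IsMetricBracket.add_sharpBilin
    {b : Sections I F V →ₗ[ℝ] Sections I F V →ₗ[ℝ] Sections I F V} (hb : IsMetricBracket g ρ b)
    (A : Π x, V x [⋀^Fin 3]→ₗ[ℝ] ℝ)
    (hA : ∀ e₁ e₂ e₃ : Sections I F V,
      ContMDiff I 𝓘(ℝ) ∞ fun x => alternatingForm A e₁ e₂ x (e₃ x)) :
    IsMetricBracket g ρ (b + g.sharpBilin (alternatingForm A) hA) where
  skew e₁ e₂ := by
    have h : g.sharpBilin (alternatingForm A) hA e₁ e₂ =
        -g.sharpBilin (alternatingForm A) hA e₂ e₁ := by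
      ext x
      refine g.eq_of_form_eq fun w => (g.form_sharpBilin _ hA e₁ e₂ x w).trans ?_
      rw [ContMDiffSection.coe_neg, Pi.neg_apply, map_neg, neg_apply]
      refine Eq.trans ?_ (congrArg Neg.neg (g.form_sharpBilin _ hA e₂ e₁ x w)).symm
      exact alternating_swap_left _ _ _ _
    simp only [LinearMap.add_apply]
    rw [hb.skew e₁ e₂, h, neg_add]
  compat e e₁ e₂ x := by
    have h1 := g.form_sharpBilin _ hA e e₁ x (e₂ x)
    have h2 := g.form_sharpBilin _ hA e e₂ x (e₁ x)
    -- Skewness in the last two slots makes the two contributions of A to the compatibility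
    -- condition cancel.
    have h3 := alternating_swap_right (A x) (e x) (e₁ x) (e₂ x)
    rw [alternatingForm_apply] at h1 h2
    rw [hb.compat e e₁ e₂ x]
    simp only [BundleMetric.pair, Pi.add_apply, LinearMap.add_apply, ContMDiffSection.coe_add,
      map_add, add_apply]
    rw [h1, g.symm x (e₁ x) (g.sharpBilin _ hA e e₂ x), h2]
    linarith

/-- A linear choice of global sections through the vectors of a fibre. -/
theorem exists_linear_extension (x : M) :
    ∃ σ : V x →ₗ[ℝ] Sections I F V, ∀ v, σ v x = v := by
  let ev : Sections I F V →ₗ[ℝ] V x :=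
    { toFun e := e x
      map_add' _ _ := rfl
      map_smul' _ _ := rfl }
  obtain ⟨σ, hσ⟩ := ev.exists_rightInverse_of_surjective
    (LinearMap.range_eq_top.2 (exists_section_apply_eq x))
  exact ⟨σ, LinearMap.congr_fun hσ⟩

section Difference

variable {b b₀ : Sections I F V →ₗ[ℝ] Sections I F V →ₗ[ℝ] Sections I F V}

theorem form_sub_swap_left (hb : IsMetricBracket g ρ b) (hb₀ : IsMetricBracket g ρ b₀)
    (e₁ e₂ : Sections I F V) (x : M) (w : V x) :
    g.form x (b e₁ e₂ x - b₀ e₁ e₂ x) w = -g.form x (b e₂ e₁ x - b₀ e₂ e₁ x) w := by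
  rw [hb.skew e₁ e₂, hb₀.skew e₁ e₂]
  simp only [ContMDiffSection.coe_neg, Pi.neg_apply, map_sub, map_neg, sub_apply, neg_apply]
  ring

/-- The compatibility conditions of b and b₀ have the same left side and the same gradient terms, so
subtracting them leaves only the brackets. -/
theorem form_sub_swap_right (hb : IsMetricBracket g ρ b) (hb₀ : IsMetricBracket g ρ b₀)
    (e₁ e₂ e₃ : Sections I F V) (x : M) :
    g.form x (b e₁ e₂ x - b₀ e₁ e₂ x) (e₃ x) = -g.form x (b e₁ e₃ x - b₀ e₁ e₃ x) (e₂ x) := by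
  have h := (hb.compat e₁ e₂ e₃ x).symm.trans (hb₀.compat e₁ e₂ e₃ x)
  simp only [BundleMetric.pair, Pi.add_apply, map_add, add_apply] at h
  rw [g.symm x (e₂ x) (b e₁ e₃ x), g.symm x (e₂ x) (b₀ e₁ e₃ x)] at h
  simp only [map_sub, sub_apply]
  linarith

/-- The last slot is pointwise by construction; the skew symmetries carry each of the other two
arguments there in turn. No Leibniz computation is needed. -/
theorem form_sub_congr (hb : IsMetricBracket g ρ b) (hb₀ : IsMetricBracket g ρ b₀)
    {e₁ e₂ e₁' e₂' : Sections I F V} {x : M} (h₁ : e₁ x = e₁' x) (h₂ : e₂ x = e₂' x) (w : V x) :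
    g.form x (b e₁ e₂ x - b₀ e₁ e₂ x) w = g.form x (b e₁' e₂' x - b₀ e₁' e₂' x) w := by
  obtain ⟨e, rfl⟩ := exists_section_apply_eq (I := I) (F := F) x w
  rw [form_sub_swap_right hb hb₀ e₁ e₂ e, h₂, ← form_sub_swap_right hb hb₀ e₁ e₂' e,
    form_sub_swap_left hb hb₀ e₁ e₂', form_sub_swap_right hb hb₀ e₂' e₁ e, h₁,
    ← form_sub_swap_right hb hb₀ e₂' e₁' e, ← form_sub_swap_left hb hb₀ e₁' e₂']

/-- The difference of two metric brackets is given by a field of alternating forms. -/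
theorem exists_alternating_of_isMetricBracket (hb : IsMetricBracket g ρ b)
    (hb₀ : IsMetricBracket g ρ b₀) (x : M) :
    ∃ A : V x [⋀^Fin 3]→ₗ[ℝ] ℝ, ∀ e₁ e₂ e₃ : Sections I F V,
      A ![e₁ x, e₂ x, e₃ x] = g.form x (b e₁ e₂ x - b₀ e₁ e₂ x) (e₃ x) := by
  -- A linear choice of extensions makes the formula for A trilinear at once; that the choice does
  -- not matter is `form_sub_congr`.
  obtain ⟨σ, hσ⟩ := exists_linear_extension (I := I) (F := F) (V := V) x
  have hs1 : ∀ u v w, g.form x (b (σ u) (σ v) x - b₀ (σ u) (σ v) x) w =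
      -g.form x (b (σ v) (σ u) x - b₀ (σ v) (σ u) x) w := fun u v w =>
    form_sub_swap_left hb hb₀ (σ u) (σ v) x w
  have hs2 : ∀ u v w, g.form x (b (σ u) (σ v) x - b₀ (σ u) (σ v) x) w =
      -g.form x (b (σ u) (σ w) x - b₀ (σ u) (σ w) x) v := fun u v w => by
    have h := form_sub_swap_right hb hb₀ (σ u) (σ v) (σ w) x
    rwa [hσ, hσ] at h
  refine ⟨{ toFun v := g.form x (b (σ (v 0)) (σ (v 1)) x - b₀ (σ (v 0)) (σ (v 1)) x) (v 2)
            map_update_add' := ?_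
            map_update_smul' := ?_
            map_eq_zero_of_eq' := ?_ }, fun e₁ e₂ e₃ => ?_⟩
  · intro inst m i u u'
    -- The multilinearity fields quantify over every decidability instance; fixing the standard one
    -- lets `simp` compute the updates.
    obtain rfl : inst = instDecidableEqFin 3 := Subsingleton.elim _ _
    fin_cases i <;>
      simp [Function.update, map_add, LinearMap.add_apply] <;> ring
  · intro inst m i c u
    obtain rfl : inst = instDecidableEqFin 3 := Subsingleton.elim _ _
    fin_cases i <;>
      simp [Function.update, map_smul, LinearMap.smul_apply] <;> ring
  · intro v i j hij hne
    have h1 := hs1 (v 0) (v 1) (v 2)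
    have h2 := hs2 (v 0) (v 1) (v 2)
    have h3 := hs1 (v 0) (v 2) (v 1)
    have h01 : v 0 = v 1 → g.form x (b (σ (v 0)) (σ (v 1)) x - b₀ (σ (v 0)) (σ (v 1)) x) (v 2) = 0 := by
      intro h; rw [h] at h1 ⊢; linarith
    have h12 : v 1 = v 2 → g.form x (b (σ (v 0)) (σ (v 1)) x - b₀ (σ (v 0)) (σ (v 1)) x) (v 2) = 0 := by
      intro h; rw [h] at h2 ⊢; linarith
    -- Swapping the last two slots makes the equal arguments adjacent, which is the first case.
    have h02 : v 0 = v 2 → g.form x (b (σ (v 0)) (σ (v 1)) x - b₀ (σ (v 0)) (σ (v 1)) x) (v 2) = 0 := by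
      intro h; rw [h] at h3 h2 ⊢; linarith
    fin_cases i <;> fin_cases j <;> first | exact absurd rfl hne | skip
    · exact h01 hij
    · exact h02 hij
    · exact h01 hij.symm
    · exact h12 hij
    · exact h02 hij.symm
    · exact h12 hij.symm
  · exact form_sub_congr hb hb₀ (hσ _) (hσ _) _

end Difference

end AlternatingForms

section Classification

variable {g : BundleMetric I F V} {ρ : Anchor I F V}

/-- The smooth `3`-form with given values on smooth sections. -/
theorem exists_threeForm (A : Π x, V x [⋀^Fin 3]→ₗ[ℝ] ℝ)
    (hA : ∀ e : Fin 3 → Sections I F V, ContMDiff I 𝓘(ℝ) ∞ fun x => A x fun i => e i x) :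
    ∃ B : ThreeForm I F V, ∀ x v, B x v = A x v := by
  have hc : ∀ x, Continuous (A x) := fun x =>
    haveI := VectorBundle.finiteDimensional ℝ F V x
    haveI : T2Space (V x) := ((trivializationAt F V x).continuousLinearEquivAt ℝ x
      (FiberBundle.mem_baseSet_trivializationAt' x)).symm.toHomeomorph.t2Space
    continuous_multilinearMap_of_finiteDimensional (A x).toMultilinearMap
  exact ⟨⟨fun x => { A x with cont := hc x }, contMDiff_form_of_apply hA⟩, fun x v => rfl⟩

theorem section_vec_eq {x : M} (e : Fin 3 → Sections I F V) :
    (fun i => e i x) = ![e 0 x, e 1 x, e 2 x] := by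
  ext i
  fin_cases i <;> rfl

/-- Metric brackets form an affine space over the `3`-forms. -/
theorem exists_equiv_threeForm
    {b₀ : Sections I F V →ₗ[ℝ] Sections I F V →ₗ[ℝ] Sections I F V}
    (hb₀ : IsMetricBracket g ρ b₀) :
    ∃ Φ : {b : Sections I F V →ₗ[ℝ] Sections I F V →ₗ[ℝ] Sections I F V //
        IsMetricBracket g ρ b} ≃ ThreeForm I F V,
      ∀ (b : {b : Sections I F V →ₗ[ℝ] Sections I F V →ₗ[ℝ] Sections I F V //
          IsMetricBracket g ρ b}) (e₁ e₂ e₃ : Sections I F V) (x : M),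
        Φ b x ![e₁ x, e₂ x, e₃ x] = g.form x (b.1 e₁ e₂ x - b₀ e₁ e₂ x) (e₃ x) := by
  have hex : ∀ b : {b : Sections I F V →ₗ[ℝ] Sections I F V →ₗ[ℝ] Sections I F V //
      IsMetricBracket g ρ b}, ∃ B : ThreeForm I F V, ∀ (e₁ e₂ e₃ : Sections I F V) (x : M),
      B x ![e₁ x, e₂ x, e₃ x] = g.form x (b.1 e₁ e₂ x - b₀ e₁ e₂ x) (e₃ x) := by
    intro b
    choose A hA using exists_alternating_of_isMetricBracket b.2 hb₀
    -- `A` was chosen point by point; its values on sections are products g(b - b₀, ·), hence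
    -- smooth.
    obtain ⟨B, hB⟩ := exists_threeForm (I := I) (F := F) A fun e => by
      simp only [section_vec_eq, hA]
      exact g.contMDiff_pair (b.1 (e 0) (e 1) - b₀ (e 0) (e 1)) (e 2)
    exact ⟨B, fun e₁ e₂ e₃ x => (hB x _).trans (hA x e₁ e₂ e₃)⟩
  choose Φ hΦ using hex
  refine ⟨Equiv.ofBijective Φ ⟨fun b b' h => ?_, fun B => ?_⟩, hΦ⟩
  · refine Subtype.ext (LinearMap.ext₂ fun e₁ e₂ => ContMDiffSection.ext fun x => ?_)
    refine sub_left_injective (b := b₀ e₁ e₂ x) (g.eq_of_form_eq fun w => ?_)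
    obtain ⟨e, rfl⟩ := exists_section_apply_eq (I := I) (F := F) x w
    exact (hΦ b e₁ e₂ e x).symm.trans ((h ▸ rfl : _ = _).trans (hΦ b' e₁ e₂ e x))
  -- Surjectivity: the preimage of B is b₀ + ♯B(e₁, e₂, ·).
  · let A : Π x, V x [⋀^Fin 3]→ₗ[ℝ] ℝ := fun x => (B x).toAlternatingMap
    have hA : ∀ e₁ e₂ e₃ : Sections I F V,
        ContMDiff I 𝓘(ℝ) ∞ fun x => alternatingForm A e₁ e₂ x (e₃ x) := by
      intro e₁ e₂ e₃ x
      have := contMDiffAt_form_apply (B.contMDiff x) ![e₁, e₂, e₃]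
      simp only [section_vec_eq] at this
      exact this
    refine ⟨⟨b₀ + g.sharpBilin (alternatingForm A) hA, hb₀.add_sharpBilin A hA⟩, ?_⟩
    refine ContMDiffSection.ext fun x => ?_
    ext v
    choose e he using fun i => exists_section_apply_eq (I := I) (F := F) x (v i)
    obtain rfl : (fun i => e i x) = v := funext he
    rw [section_vec_eq, hΦ]
    simp only [LinearMap.add_apply, ContMDiffSection.coe_add, Pi.add_apply, add_sub_cancel_left]
    exact g.form_sharpBilin _ hA _ _ x _

end Classification

end MetricAlgebroid

end

/-! ### Existence of metric connections along the anchor. -/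

noncomputable section

namespace MetricAlgebroid

open Bundle Filter Topology

variable {EM : Type*} [NormedAddCommGroup EM] [NormedSpace ℝ EM] [FiniteDimensional ℝ EM]
  {H : Type*} [TopologicalSpace H] {I : ModelWithCorners ℝ EM H}
  {M : Type*} [TopologicalSpace M] [ChartedSpace H M] [IsManifold I ∞ M]
  [T2Space M] [SigmaCompactSpace M]
  {F : Type*} [NormedAddCommGroup F] [NormedSpace ℝ F] [FiniteDimensional ℝ F]
  {V : M → Type*} [TopologicalSpace (TotalSpace F V)]
  [∀ x, AddCommGroup (V x)] [∀ x, Module ℝ (V x)] [∀ x, TopologicalSpace (V x)]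
  [∀ x, IsTopologicalAddGroup (V x)] [∀ x, ContinuousSMul ℝ (V x)]
  [FiberBundle F V] [VectorBundle ℝ F V] [ContMDiffVectorBundle ∞ F V I]

section LocalForm

variable (g : BundleMetric I F V) (ρ : Anchor I F V)

theorem contMDiffAt_anchor_apply (e : Sections I F V) (x : M) :
    ContMDiffAt I I.tangent ∞ (fun y => (⟨y, ρ y (e y)⟩ : TangentBundle I M)) x :=
  ContMDiffAt.clm_bundle_apply (E₂ := fun x : M => TangentSpace I x) (b := id)
    ρ.contMDiff.contMDiffAt e.contMDiff.contMDiffAt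

/-- The derivative `v ↦ (ρ v) f` at a point. -/
def anchorDual (f : M → ℝ) (x : M) : Module.Dual ℝ (V x) :=
  (((mvfderiv I f x).comp (ρ x) : V x →L[ℝ] ℝ) : V x →ₗ[ℝ] ℝ)

theorem anchorDual_apply (f : M → ℝ) (x : M) (v : V x) :
    anchorDual ρ f x v = mvfderiv I f x (ρ x v) := rfl

variable (t : Trivialization F (TotalSpace.proj : TotalSpace F V → M)) [MemTrivializationAtlas t]
  {ι : Type*} [Fintype ι] (b : Module.Basis ι ℝ F)

/-- The coefficient functions of a section in a local frame. -/
def frameCoeff (k : ι) (e : Π x, V x) (x : M) : ℝ := t.localFrameCoeff I b k x (e x)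

/-- The form `(v, w) ↦ g(∇_{ρ v} e, w)` for the metric connection `∇ = d + (1/2) g⁻¹ dg` given by
a trivialization. -/
def localForm (e : Π x, V x) (x : M) : V x →ₗ[ℝ] V x →ₗ[ℝ] ℝ :=
  (1 / 2 : ℝ) • ∑ k,
    ((anchorDual ρ (g.pair e (t.localFrame b k)) x).smulRight (t.localFrameCoeff I b k x) +
      (anchorDual ρ (frameCoeff (I := I) t b k e) x).smulRight (g.flat x (t.localFrame b k x)))

theorem localForm_apply (e e' : Π x, V x) (x : M) (v : V x) :
    localForm g ρ t b e x v (e' x) = 1 / 2 * ∑ k,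
      (anchorDual ρ (g.pair e (t.localFrame b k)) x v * frameCoeff (I := I) t b k e' x +
        anchorDual ρ (frameCoeff (I := I) t b k e) x v * g.pair (t.localFrame b k) e' x) := by
  simp only [localForm, LinearMap.smul_apply, LinearMap.sum_apply, LinearMap.add_apply,
    LinearMap.smulRight_apply, smul_eq_mul]
  rfl

variable {t} {x : M} (hx : x ∈ t.baseSet)
include hx

theorem contMDiffAt_frameCoeff (e : Sections I F V) (k : ι) :
    ContMDiffAt I 𝓘(ℝ) ∞ (frameCoeff (I := I) t b k e) x :=
  contMDiffAt_localFrameCoeff b hx e.contMDiff.contMDiffAt k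

theorem contMDiffAt_pair_localFrame (e : Sections I F V) (k : ι) :
    ContMDiffAt I 𝓘(ℝ) ∞ (g.pair e (t.localFrame b k)) x :=
  g.contMDiffAt_pair e.contMDiff.contMDiffAt (contMDiffAt_localFrame_of_mem ∞ t b k hx)

theorem contMDiffAt_localForm (e e₁ e₂ : Sections I F V) :
    ContMDiffAt I 𝓘(ℝ) ∞ (fun y => localForm g ρ t b e y (e₁ y) (e₂ y)) x := by
  simp only [localForm_apply]
  refine contMDiffAt_const.mul (contMDiffAt_finsetSum fun k _ => ContMDiffAt.add ?_ ?_)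
  · exact (contMDiffAt_mvfderiv_apply (contMDiffAt_pair_localFrame g b hx e k)
      (contMDiffAt_anchor_apply ρ e₁ x)).mul (contMDiffAt_frameCoeff b hx e₂ k)
  · refine (contMDiffAt_mvfderiv_apply (contMDiffAt_frameCoeff b hx e k)
      (contMDiffAt_anchor_apply ρ e₁ x)).mul ?_
    rw [g.pair_comm]
    exact contMDiffAt_pair_localFrame g b hx e₂ k

/-- The point must lie in the base set, where the coefficients and products being differentiated are
known to be differentiable. -/
theorem localForm_add (e e' : Sections I F V) :
    localForm g ρ t b (e + e' : Sections I F V) x =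
      localForm g ρ t b e x + localForm g ρ t b e' x := by
  have h1 : ∀ k, anchorDual ρ (g.pair (e + e' : Sections I F V) (t.localFrame b k)) x =
      anchorDual ρ (g.pair e (t.localFrame b k)) x +
        anchorDual ρ (g.pair e' (t.localFrame b k)) x := fun k => by
    have h : g.pair (e + e' : Sections I F V) (t.localFrame b k) =
        g.pair e (t.localFrame b k) + g.pair e' (t.localFrame b k) := by
      ext y; simp [BundleMetric.pair]
    ext v
    simp only [anchorDual_apply, LinearMap.add_apply]
    rw [h, mvfderiv_add ((contMDiffAt_pair_localFrame g b hx e k).mdifferentiableAt (by simp))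
      ((contMDiffAt_pair_localFrame g b hx e' k).mdifferentiableAt (by simp))]
    rfl
  have h2 : ∀ k, anchorDual ρ (frameCoeff (I := I) t b k (e + e' : Sections I F V)) x =
      anchorDual ρ (frameCoeff (I := I) t b k e) x +
        anchorDual ρ (frameCoeff (I := I) t b k e') x := fun k => by
    have h : frameCoeff (I := I) t b k (e + e' : Sections I F V) =
        frameCoeff (I := I) t b k e + frameCoeff (I := I) t b k e' := by
      ext y; simp [frameCoeff]
    ext v
    simp only [anchorDual_apply, LinearMap.add_apply]
    rw [h, mvfderiv_add ((contMDiffAt_frameCoeff b hx e k).mdifferentiableAt (by simp))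
      ((contMDiffAt_frameCoeff b hx e' k).mdifferentiableAt (by simp))]
    rfl
  ext v w
  simp only [localForm, h1, h2, LinearMap.smul_apply, LinearMap.sum_apply, LinearMap.add_apply,
    LinearMap.smulRight_apply, smul_eq_mul, ← mul_add, ← Finset.sum_add_distrib]
  congr 1
  exact Finset.sum_congr rfl fun k _ => by ring

theorem localForm_smul (c : ℝ) (e : Sections I F V) :
    localForm g ρ t b (c • e : Sections I F V) x = c • localForm g ρ t b e x := by
  have h1 : ∀ k, anchorDual ρ (g.pair (c • e : Sections I F V) (t.localFrame b k)) x =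
      c • anchorDual ρ (g.pair e (t.localFrame b k)) x := fun k => by
    have h : g.pair (c • e : Sections I F V) (t.localFrame b k) =
        fun y => c * g.pair e (t.localFrame b k) y := by
      ext y; simp [BundleMetric.pair]
    ext v
    simp only [anchorDual_apply, LinearMap.smul_apply]
    rw [h, mvfderiv_const_mul
      ((contMDiffAt_pair_localFrame g b hx e k).mdifferentiableAt (by simp))]
    rfl
  have h2 : ∀ k, anchorDual ρ (frameCoeff (I := I) t b k (c • e : Sections I F V)) x =
      c • anchorDual ρ (frameCoeff (I := I) t b k e) x := fun k => by
    have h : frameCoeff (I := I) t b k (c • e : Sections I F V) =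
        fun y => c * frameCoeff (I := I) t b k e y := by
      ext y; simp [frameCoeff]
    ext v
    simp only [anchorDual_apply, LinearMap.smul_apply]
    rw [h, mvfderiv_const_mul ((contMDiffAt_frameCoeff b hx e k).mdifferentiableAt (by simp))]
    rfl
  ext v w
  simp only [localForm, h1, h2, LinearMap.smul_apply, LinearMap.sum_apply, LinearMap.add_apply,
    LinearMap.smulRight_apply, smul_eq_mul, mul_left_comm c, Finset.mul_sum]
  exact Finset.sum_congr rfl fun k _ => by ring

/-- The product rule for g(e₁, e₂) = ∑ₖ e₂ᵏ g(e₁, sₖ), where sₖ is the local frame; this identity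
holds on the base set only. -/
theorem mvfderiv_pair_eq_sum (e₁ e₂ : Sections I F V) :
    mvfderiv I (g.pair e₁ e₂) x = ∑ k,
      (frameCoeff (I := I) t b k e₂ x • mvfderiv I (g.pair e₁ (t.localFrame b k)) x +
        g.pair e₁ (t.localFrame b k) x • mvfderiv I (frameCoeff (I := I) t b k e₂) x) := by
  have h : g.pair e₁ e₂ =ᶠ[𝓝 x]
      ∑ k, frameCoeff (I := I) t b k e₂ * g.pair e₁ (t.localFrame b k) := by
    filter_upwards [t.open_baseSet.mem_nhds hx] with y hy
    have hy' := t.eq_sum_localFrameCoeff_smul (I := I) (b := b) (s := e₂) hy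
    simp only [BundleMetric.pair, Finset.sum_apply, Pi.mul_apply]
    conv_lhs => rw [hy']
    simp only [map_sum, map_smul, smul_eq_mul]
    rfl
  -- Differentiability of the partial sums is carried along, since the sum rule needs it at each
  -- step.
  have hs : ∀ s : Finset ι, MDifferentiableAt I 𝓘(ℝ)
      (∑ k ∈ s, frameCoeff (I := I) t b k e₂ * g.pair e₁ (t.localFrame b k)) x ∧
      mvfderiv I (∑ k ∈ s, frameCoeff (I := I) t b k e₂ * g.pair e₁ (t.localFrame b k)) x =
      ∑ k ∈ s,
      (frameCoeff (I := I) t b k e₂ x • mvfderiv I (g.pair e₁ (t.localFrame b k)) x +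
        g.pair e₁ (t.localFrame b k) x • mvfderiv I (frameCoeff (I := I) t b k e₂) x) := by
    classical
    intro s
    induction s using Finset.induction_on with
    | empty => exact ⟨mdifferentiableAt_const, mvfderiv_zero⟩
    | insert k s hk ih =>
      have h1 := (contMDiffAt_frameCoeff b hx e₂ k).mdifferentiableAt (by simp)
      have h2 := (contMDiffAt_pair_localFrame g b hx e₁ k).mdifferentiableAt (by simp)
      rw [Finset.sum_insert hk, Finset.sum_insert hk, mvfderiv_add (h1.mul h2) ih.1, ih.2,
        mvfderiv_mul h1 h2]
      exact ⟨(h1.mul h2).add ih.1, rfl⟩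
  rw [← (hs Finset.univ).2]
  ext v
  exact congrArg (fun l : EM →L[ℝ] ℝ => l v) h.mfderiv_eq

/-- Expand d g(e₁, e₂) in the frame coefficients of e₂, then of e₁, and average: the terms are those
of the two local forms. The factor 1/2 in `localForm` is this average. -/
theorem mvfderiv_pair_eq_localForm (e₁ e₂ : Sections I F V) (v : V x) :
    mvfderiv I (g.pair e₁ e₂) x (ρ x v) =
      localForm g ρ t b e₁ x v (e₂ x) + localForm g ρ t b e₂ x v (e₁ x) := by
  have h1 := congrArg (fun l => l (ρ x v)) (mvfderiv_pair_eq_sum g b hx e₁ e₂)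
  have h2 := congrArg (fun l => l (ρ x v)) (mvfderiv_pair_eq_sum g b hx e₂ e₁)
  rw [g.pair_comm e₂ e₁] at h2
  simp only [sum_apply, add_apply, smul_apply, smul_eq_mul, Finset.sum_add_distrib] at h1 h2
  simp only [localForm_apply, anchorDual_apply, Finset.sum_add_distrib,
    g.pair_comm (t.localFrame b _)]
  simp only [mul_comm (mvfderiv I _ x _)]
  linarith

end LocalForm

/-- Metric connections along the anchor exist. -/
theorem nonempty_anchoredConnection (g : BundleMetric I F V) (ρ : Anchor I F V) :
    Nonempty (AnchoredConnection g ρ) := by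
  let b := Module.finBasis ℝ F
  obtain ⟨φ, hφ⟩ := SmoothPartitionOfUnity.exists_isSubordinate I (s := Set.univ) isClosed_univ
    (fun i : M => (trivializationAt F V i).baseSet) (fun i => (trivializationAt F V i).open_baseSet)
    (fun i _ => Set.mem_iUnion.2 ⟨i, FiberBundle.mem_baseSet_trivializationAt' i⟩)
  -- Every index in the finite sum at x has x in its base set, so the local lemmas apply to each
  -- summand.
  have hmem : ∀ {x i}, i ∈ φ.finsupport x → x ∈ (trivializationAt F V i).baseSet := fun h =>
    hφ _ (subset_tsupport _ ((φ.mem_finsupport _).1 h))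
  refine ⟨{
    toFun :=
      { toFun e x := ∑ i ∈ φ.finsupport x, φ i x • localForm g ρ (trivializationAt F V i) b e x
        map_add' := fun e e' => ?_
        map_smul' := fun c e => ?_ }
    contMDiff := fun e e₁ e₂ => ?_
    preserves := fun e₁ e₂ x v => ?_ }⟩
  · ext1 x
    rw [Pi.add_apply, ← Finset.sum_add_distrib]
    exact Finset.sum_congr rfl fun i hi => by rw [localForm_add g ρ b (hmem hi), smul_add]
  · ext1 x
    rw [RingHom.id_apply, Pi.smul_apply, Finset.smul_sum]
    exact Finset.sum_congr rfl fun i hi => by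
      rw [localForm_smul g ρ b (hmem hi), smul_comm]
  · have h := φ.contMDiff_finsum_smul (n := (⊤ : ℕ∞))
      (g := fun i y => localForm g ρ (trivializationAt F V i) b e y (e₁ y) (e₂ y))
      fun i x hx => contMDiffAt_localForm g ρ b (hφ i hx) e e₁ e₂
    refine h.congr fun x => ?_
    refine Eq.trans ?_ (φ.sum_finsupport_smul_eq_finsum x
      fun i y => localForm g ρ (trivializationAt F V i) b e y (e₁ y) (e₂ y))
    simp [LinearMap.sum_apply, LinearMap.smul_apply]
  -- Metric compatibility is an affine condition, so it survives averaging with weights of sum 1.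
  · have h : ∑ i ∈ φ.finsupport x, φ i x * mvfderiv I (g.pair e₁ e₂) x (ρ x v) =
        mvfderiv I (g.pair e₁ e₂) x (ρ x v) := by
      rw [← Finset.sum_mul, φ.sum_finsupport x (Set.mem_univ x), one_mul]
    rw [← h]
    simp only [LinearMap.coe_mk, AddHom.coe_mk, LinearMap.sum_apply, LinearMap.smul_apply,
      smul_eq_mul, ← Finset.sum_add_distrib, ← mul_add]
    exact Finset.sum_congr rfl fun i hi => by
      rw [mvfderiv_pair_eq_localForm g ρ b (hmem hi)]

end MetricAlgebroid

end

/-! ### Nonzero 3-forms and infinitely many products. -/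

noncomputable section

namespace MetricAlgebroid

open Bundle Filter Topology

variable {EM : Type*} [NormedAddCommGroup EM] [NormedSpace ℝ EM] [FiniteDimensional ℝ EM]
  {H : Type*} [TopologicalSpace H] {I : ModelWithCorners ℝ EM H}
  {M : Type*} [TopologicalSpace M] [ChartedSpace H M] [IsManifold I ∞ M]
  [T2Space M] [SigmaCompactSpace M]
  {F : Type*} [NormedAddCommGroup F] [NormedSpace ℝ F] [FiniteDimensional ℝ F]
  {V : M → Type*} [TopologicalSpace (TotalSpace F V)]
  [∀ x, AddCommGroup (V x)] [∀ x, Module ℝ (V x)] [∀ x, TopologicalSpace (V x)]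
  [∀ x, IsTopologicalAddGroup (V x)] [∀ x, ContinuousSMul ℝ (V x)]
  [FiberBundle F V] [VectorBundle ℝ F V] [ContMDiffVectorBundle ∞ F V I]

/-- In rank at least three there is a field of alternating trilinear forms which is smooth on
sections and does not vanish at a given point. -/
theorem exists_alternating_ne_zero (g : BundleMetric I F V) (hF : 3 ≤ Module.finrank ℝ F) (x₀ : M) :
    ∃ A : Π x, V x [⋀^Fin 3]→ₗ[ℝ] ℝ,
      (∀ e : Fin 3 → Sections I F V, ContMDiff I 𝓘(ℝ) ∞ fun x => A x fun i => e i x) ∧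
      ∃ e : Fin 3 → Sections I F V, A x₀ (fun i => e i x₀) ≠ 0 := by
  have : FiniteDimensional ℝ (V x₀) := VectorBundle.finiteDimensional ℝ F V x₀
  let b := Module.finBasisOfFinrankEq ℝ (V x₀) (VectorBundle.finrank_eq ℝ F V x₀)
  -- The covectors g(Sᵢ, ·) extend three members of the dual basis at x₀. The form det(g(Sᵢ, eⱼ)) is
  -- globally smooth and equals 1 on the corresponding basis vectors at x₀.
  choose S hS using fun i : Fin 3 =>
    exists_section_apply_eq (I := I) (F := F) x₀ (g.sharp x₀ (b.coord (Fin.castLE hF i)))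
  choose e he using fun i : Fin 3 =>
    exists_section_apply_eq (I := I) (F := F) x₀ (b (Fin.castLE hF i))
  refine ⟨fun x => (Matrix.detRowAlternating (n := Fin 3) (R := ℝ)).compLinearMap
    (LinearMap.pi fun i => g.flat x (S i x)), fun e' x => ?_, e, ?_⟩
  · exact contMDiffAt_matrix_det (A := fun x => Matrix.of fun j i => g.form x (S i x) (e' j x))
      fun j i => (g.contMDiff_pair (S i) (e' j)).contMDiffAt
  · have h : (fun j i => g.flat x₀ (S i x₀) (e j x₀)) = (1 : Matrix (Fin 3) (Fin 3) ℝ) := by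
      ext j i
      rw [he, hS, g.flat_apply, g.form_sharp, b.coord_apply, b.repr_self, Matrix.one_apply,
        Finsupp.single_apply]
      simp only [Fin.castLE_inj]
    refine ne_of_eq_of_ne (b := (1 : ℝ)) ?_ one_ne_zero
    exact (congrArg Matrix.det h).trans Matrix.det_one

/-- In rank at least three, a metric bracket gives rise to infinitely many metric products. -/
theorem IsMetricBracket.infinite_isMetricProduct [Nonempty M] {g : BundleMetric I F V}
    {ρ : Anchor I F V} {b : Sections I F V →ₗ[ℝ] Sections I F V →ₗ[ℝ] Sections I F V}
    (hb : IsMetricBracket g ρ b) (hF : 3 ≤ Module.finrank ℝ F) :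
    {P : Sections I F V →ₗ[ℝ] Sections I F V →ₗ[ℝ] Sections I F V |
      IsMetricProduct g ρ P}.Infinite := by
  obtain ⟨A, hA, e, he⟩ := exists_alternating_ne_zero g hF (Classical.arbitrary M)
  have hs : ∀ (t : ℝ) (e₁ e₂ e₃ : Sections I F V),
      ContMDiff I 𝓘(ℝ) ∞ fun x => alternatingForm (fun x => t • A x) e₁ e₂ x (e₃ x) := by
    intro t e₁ e₂ e₃
    have h : ContMDiff I 𝓘(ℝ) ∞ fun x => t • A x fun i => ![e₁, e₂, e₃] i x :=
      (contMDiff_const (c := t)).mul (hA ![e₁, e₂, e₃])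
    simp only [section_vec_eq] at h
    exact h
  -- The products are indexed by t ∈ ℝ, through the 3-forms tA; evaluating at the point where A does
  -- not vanish recovers t.
  refine Set.infinite_of_injective_forall_mem (f := fun t : ℝ =>
    b + g.sharpBilin (alternatingForm fun x => t • A x) (hs t) + gradPair g ρ) (fun t t' h => ?_)
    fun t => (hb.add_sharpBilin _ (hs t)).isMetricProduct
  have h1 := add_left_cancel (add_right_cancel h)
  have h2 := congrArg (fun B : Sections I F V →ₗ[ℝ] Sections I F V →ₗ[ℝ] Sections I F V =>
    g.form (Classical.arbitrary M) (B (e 0) (e 1) (Classical.arbitrary M))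
      (e 2 (Classical.arbitrary M))) h1
  have h3 := (g.form_sharpBilin _ (hs t) _ _ _ _).symm.trans
    (h2.trans (g.form_sharpBilin _ (hs t') _ _ _ _))
  have h4 : t * A (Classical.arbitrary M) ![e 0 _, e 1 _, e 2 _] =
    t' * A (Classical.arbitrary M) ![e 0 _, e 1 _, e 2 _] := h3
  rw [← section_vec_eq] at h4
  exact mul_right_cancel₀ he h4

end MetricAlgebroid

end

open MetricAlgebroid in
theorem proposition2p3
    {EM : Type*} [NormedAddCommGroup EM] [NormedSpace ℝ EM] [FiniteDimensional ℝ EM]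
    {H : Type*} [TopologicalSpace H] (I : ModelWithCorners ℝ EM H)
    {M : Type*} [TopologicalSpace M] [ChartedSpace H M] [IsManifold I ∞ M]
    [BoundarylessManifold I M] [T2Space M] [SigmaCompactSpace M]
    (F : Type*) [NormedAddCommGroup F] [NormedSpace ℝ F] [FiniteDimensional ℝ F]
    (V : M → Type*) [TopologicalSpace (Bundle.TotalSpace F V)]
    [∀ x, AddCommGroup (V x)] [∀ x, Module ℝ (V x)] [∀ x, TopologicalSpace (V x)]
    [∀ x, IsTopologicalAddGroup (V x)] [∀ x, ContinuousSMul ℝ (V x)]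
    [FiberBundle F V] [VectorBundle ℝ F V] [ContMDiffVectorBundle ∞ F V I]
    (g : BundleMetric I F V) (ρ : Anchor I F V) :
    -- there are metric algebroid structures on `(V, g, ρ)`, infinitely many if the rank is `≥ 3`
    {P : Sections I F V →ₗ[ℝ] Sections I F V →ₗ[ℝ] Sections I F V |
        IsMetricProduct g ρ P}.Nonempty ∧
    (Nonempty M → 3 ≤ Module.finrank ℝ F →
      {P : Sections I F V →ₗ[ℝ] Sections I F V →ₗ[ℝ] Sections I F V |
        IsMetricProduct g ρ P}.Infinite) ∧
    -- every smooth `g`-preserving connection defines a metric bracket `b₀`, and the brackets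
    -- `b` correspond bijectively to the `3`-forms `B` by `B(e₁, e₂, e₃) = g(b e₁ e₂ - b₀ e₁ e₂, e₃)`
    ∀ nabla : CovariantDerivative I F V, nabla.ContMDiffCovariantDerivative ∞ →
      Preserves nabla g →
      ∃ b₀ : Sections I F V →ₗ[ℝ] Sections I F V →ₗ[ℝ] Sections I F V,
        (∀ (e₁ e₂ : Sections I F V) (x : M), b₀ e₁ e₂ x = nablaBracket g ρ nabla e₁ e₂ x) ∧
        IsMetricBracket g ρ b₀ ∧
        ∃ Φ : {b : Sections I F V →ₗ[ℝ] Sections I F V →ₗ[ℝ] Sections I F V //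
            IsMetricBracket g ρ b} ≃ ThreeForm I F V,
          ∀ (b : {b : Sections I F V →ₗ[ℝ] Sections I F V →ₗ[ℝ] Sections I F V //
              IsMetricBracket g ρ b}) (e₁ e₂ e₃ : Sections I F V) (x : M),
            Φ b x ![e₁ x, e₂ x, e₃ x] = g.form x (b.1 e₁ e₂ x - b₀ e₁ e₂ x) (e₃ x) := by
  obtain ⟨T⟩ := nonempty_anchoredConnection g ρ
  refine ⟨⟨_, T.isMetricBracket_bracket.isMetricProduct⟩,
    fun _ hF => T.isMetricBracket_bracket.infinite_isMetricProduct hF,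
    fun nabla hs hg => ⟨(AnchoredConnection.ofCovariantDerivative ρ nabla hs hg).bracket,
      AnchoredConnection.bracket_ofCovariantDerivative ρ nabla hs hg,
      AnchoredConnection.isMetricBracket_bracket _, ?_⟩⟩
  exact exists_equiv_threeForm (AnchoredConnection.isMetricBracket_bracket _)
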